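/- Let $\mathcal H,\mathcal K$ be finite dimensional complex Hilbert spaces, let $\Phi:B(\mathcal H)\to B(\mathcal K)$ be a quantum channel, that is, a completely positive trace-preserving linear map, and let $1<\alpha<\infty$. Let $\rho,\sigma$ be states on $B(\mathcal H)$ (positive operators on $\mathcal H$ with unit trace) such that $\mathrm{supp}(\rho)\subseteq\mathrm{supp}(\sigma)$, where the support of a positive operator is the orthogonal complement of its kernel. Then the following are equivalent: 1. $\Phi$ is sufficient with respect to $\{\rho,\sigma\}$, that is, there is a quantum channel $\Psi:B(\mathcal K)\to B(\mathcal H)$ such that $\Psi\circ\Phi(\rho)=\rho$ and $\Psi\circ\Phi(\sigma)=\sigma$; 2. $\tilde D_\alpha(\Phi(\rho)\|\Phi(\sigma))=\tilde D_\alpha(\rho\|\sigma)$. Here $\tilde D_\alpha$ is the sandwiched Rényi relative $\alpha$-entropy: for states $\rho,\sigma$ on the same algebra, \[ \tilde D_\alpha(\rho\|\sigma)=\begin{cases}\dfrac{1}{\alpha-1}\log_2\mathrm{Tr}\Big[\big(\sigma^{\frac{1-\alpha}{2\alpha}}\rho\,\sigma^{\frac{1-\alpha}{2\alpha}}\big)^{\alpha}\Big]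 & \text{if }\mathrm{supp}(\rho)\subseteq\mathrm{supp}(\sigma),\\[1ex] \infty & \text{otherwise,}\end{cases} \] where negative powers of $\sigma$ are taken on $\mathrm{supp}(\sigma)$ and extended by $0$ to its orthogonal complement. -/

import Mathlib

open scoped CStarAlgebra

noncomputable section

namespace QuantumRenyi

variable {H : Type*} [NormedAddCommGroup H] [InnerProductSpace ℂ H] [CompleteSpace H]
variable {K : Type*} [NormedAddCommGroup K] [InnerProductSpace ℂ K] [CompleteSpace K]

/-- The trace of an operator on a finite dimensional Hilbert space. -/
def trace (X : H →L[ℂ] H) : ℂ := LinearMap.trace ℂ H X.toLinearMap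

/-- A state is a positive operator of unit trace (`≤` is the Loewner order). -/
structure IsState (ρ : H →L[ℂ] H) : Prop where
  nonneg : 0 ≤ ρ
  trace_eq_one : trace ρ = 1

/-- The support of an operator: the orthogonal complement of its kernel. -/
def supp (X : H →L[ℂ] H) : Submodule ℂ H := (LinearMap.ker X.toLinearMap)ᗮ

variable (H K) in
/-- A quantum channel from `B(H)` to `B(K)`: a completely positive trace-preserving linear map. -/
structure QuantumChannel extends (H →L[ℂ] H) →CP (K →L[ℂ] K) where
  trace_map (X : H →L[ℂ] H) : trace (toLinearMap X) = trace X

instance : CoeFun (QuantumChannel H K) (fun _ => (H →L[ℂ] H) → (K →L[ℂ] K)) where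
  coe Φ := Φ.toLinearMap

/-- `Φ` is sufficient with respect to `{ρ, σ}`: some channel `Ψ` recovers both operators. -/
def QuantumChannel.IsSufficient (Φ : QuantumChannel H K) (ρ σ : H →L[ℂ] H) : Prop :=
  ∃ Ψ : QuantumChannel K H, Ψ (Φ ρ) = ρ ∧ Ψ (Φ σ) = σ

open Classical in
/-- The sandwiched Rényi relative `α`-entropy of positive operators, for `0 < α`, `α ≠ 1`,
with logarithm to base 2. The powers are those of the continuous functional calculus, where
`0 ^ s = 0` for every `s ≠ 0`, also for `s < 0`: a negative power of `σ` is taken on the support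
of `σ` and extended by zero. The trace is a nonnegative real number. -/
def sandwichedRenyi (α : ℝ) (ρ σ : H →L[ℂ] H) : EReal :=
  if supp ρ ≤ supp σ then
    ((1 / (α - 1) * Real.logb 2
      (trace ((σ ^ ((1 - α) / (2 * α)) * ρ * σ ^ ((1 - α) / (2 * α))) ^ α)).re : ℝ) : EReal)
  else ⊤

end QuantumRenyi

end

/-! Write Q and Q' for the traces inside the entropies of (ρ, σ) and (Φ ρ, Φ σ). All four operators
stay on the relevant supports and Q, Q' > 0, so equality of entropies means Q = Q'. Sufficiency
gives Q = Q' by data processing applied to Φ and to the recovery channel.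

Data processing (`sandwichedTrace_le`) is complex interpolation. The entire function `pairing` takes
the value Q' at z = 1/α and is bounded by Q' on Re z = 0 and by Q on Re z = 1, so the three lines
theorem gives Q' ≤ Q' ^ (1 - 1/α) * Q ^ (1/α).

If Q' = Q, the modulus of `pairing` is maximal at the interior point 1/α, so `pairing` is constant
on the strip. On Re z = 1/2 it is a Hilbert–Schmidt inner product of V a with an element of squared
norm at most Q, where ‖a‖² ≤ Q and V a = (Φ σ)^(-1/4) Φ(σ^(1/4) a σ^(1/4)) (Φ σ)^(-1/4).
Cauchy–Schwarz forces ‖V a‖ ≥ ‖a‖. The positive symmetric map T = V*V fixes σ^(1/2) and sends 1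
below a multiple of it, hence is a contraction and T a = a
(`IsFaithfulTrace.eq_of_le_quadratic_form`). Thus the Petz map after Φ fixes `family` on this line,
and by the identity theorem everywhere; at z = 1/α the family is ρ. `exists_petz_completion` turns
the Petz map into a channel. -/

open scoped CStarAlgebra

noncomputable section

namespace QuantumRenyi

open scoped ComplexOrder

set_option linter.unusedSectionVars false

/-! ### Complex powers on the support -/

section ComplexPower

variable {A : Type*} [CStarAlgebra A] [PartialOrder A] [StarOrderedRing A]

/-- The spectrum of an element of a finite dimensional algebra is finite. -/
theorem finite_spectrum [FiniteDimensional ℂ A] (a : A) : (spectrum ℂ a).Finite := by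
  have hint : IsIntegral ℂ a := Algebra.IsIntegral.isIntegral a
  have hne : minpoly ℂ a ≠ 0 := minpoly.ne_zero hint
  refine ((minpoly ℂ a).roots.toFinset.finite_toSet).subset fun x hx => ?_
  have h := spectrum.subset_polynomial_aeval a (minpoly ℂ a) ⟨x, hx, rfl⟩
  rw [minpoly.aeval] at h
  have h0 : (minpoly ℂ a).eval x = 0 := by
    by_contra h1
    rw [spectrum.mem_iff, sub_zero] at h
    exact h ((Ne.isUnit h1).map (algebraMap ℂ A))
  simp [hne, Polynomial.IsRoot, h0]

/-- Complex powers of a nonnegative element, taken on the support and extended by zero. -/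
def cpw (a : A) (z : ℂ) : A := cfc (fun x : ℂ => if x = 0 then 0 else x ^ z) a

variable [FiniteDimensional ℂ A]

/-- The value 0 at x = 0 makes the exponent law hold for all exponents. Hence `cpw a 0` is
idempotent (the support projection for `0 ≤ a`) and negative powers invert positive ones on the
support. -/
theorem cpw_add (a : A) (z w : ℂ) : cpw a (z + w) = cpw a z * cpw a w := by
  rw [cpw, cpw, cpw, ← cfc_mul _ _ a ((finite_spectrum a).continuousOn _)
    ((finite_spectrum a).continuousOn _)]
  congr 1
  ext x
  split_ifs with h
  · simp
  · exact Complex.cpow_add _ _ h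

theorem cpw_one {a : A} (ha : 0 ≤ a) : cpw a 1 = a := by
  conv_rhs => rw [← cfc_id' ℂ a (IsSelfAdjoint.of_nonneg ha).isStarNormal]
  rw [cpw]
  congr 1
  ext x
  split_ifs with h <;> simp [h]

theorem star_cpw {a : A} (ha : 0 ≤ a) (z : ℂ) :
    star (cpw a z) = cpw a (starRingEnd ℂ z) := by
  rw [cpw, cpw, ← cfc_star]
  refine cfc_congr fun x hx => ?_
  have hx0 : 0 ≤ x := spectrum_nonneg_of_nonneg ha hx
  split_ifs with h
  · simp
  · rw [Complex.cpow_conj]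
    · rw [Complex.conj_eq_iff_im.2 (Complex.le_def.1 hx0).2.symm]; rfl
    · rw [Complex.arg_eq_zero_iff.2 ⟨(Complex.le_def.1 hx0).1, (Complex.le_def.1 hx0).2.symm⟩]
      exact Real.pi_pos.ne

theorem isSelfAdjoint_cpw {a : A} (ha : 0 ≤ a) (r : ℝ) : IsSelfAdjoint (cpw a r) := by
  rw [IsSelfAdjoint, star_cpw ha, Complex.conj_ofReal]

theorem cpw_nonneg {a : A} (ha : 0 ≤ a) (r : ℝ) : 0 ≤ cpw a r := by
  have h : cpw a r = star (cpw a ((r / 2 : ℝ) : ℂ)) * cpw a ((r / 2 : ℝ) : ℂ) := by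
    rw [(isSelfAdjoint_cpw ha _).star_eq, ← cpw_add]
    congr 1
    push_cast
    ring
  rw [h]
  exact star_mul_self_nonneg _

/-- The exponent 0 is excluded because `a ^ (0 : ℝ)` is 1, while `cpw a 0` is the support
projection. -/
theorem rpow_eq_cpw {a : A} (ha : 0 ≤ a) {r : ℝ} (hr : r ≠ 0) : a ^ r = cpw a r := by
  rw [CFC.rpow_def, cfc_nnreal_eq_real _ a ha, cfc_real_eq_complex _ (IsSelfAdjoint.of_nonneg ha),
    cpw]
  refine cfc_congr fun x hx => ?_
  have hx0 : 0 ≤ x := spectrum_nonneg_of_nonneg ha hx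
  obtain ⟨y, hy, rfl⟩ := (RCLike.nonneg_iff_exists_ofReal (K := ℂ)).1 hx0
  split_ifs with h
  · simp at h
    simp [h, hr]
  · simp [Complex.ofReal_cpow hy, max_eq_left hy]

/-- The spectral decomposition isolates the dependence on `z` in scalar exponentials, which makes
`cpw a` entire. -/
theorem cpw_eq_sum (a : A) (z : ℂ) :
    cpw a z = ∑ x ∈ (finite_spectrum a).toFinset,
      (if x = 0 then 0 else x ^ z) • cfc (fun y : ℂ => if y = x then 1 else 0) a := by
  have h : ∀ x ∈ (finite_spectrum a).toFinset,
      (if x = 0 then 0 else x ^ z) • cfc (fun y : ℂ => if y = x then 1 else 0) a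
        = cfc (fun y : ℂ => (if x = 0 then 0 else x ^ z) • (if y = x then (1 : ℂ) else 0)) a :=
    fun x _ => (cfc_smul _ _ a ((finite_spectrum a).continuousOn _)).symm
  rw [Finset.sum_congr rfl h, ← cfc_sum _ a _ fun _ _ => ((finite_spectrum a).continuousOn _), cpw]
  refine cfc_congr fun y hy => ?_
  simp [Finset.sum_apply, hy]

theorem differentiable_cpw (a : A) : Differentiable ℂ (cpw a) := by
  have h : cpw a = fun z => ∑ x ∈ (finite_spectrum a).toFinset,
      (if x = 0 then 0 else x ^ z) • cfc (fun y : ℂ => if y = x then 1 else 0) a :=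
    funext (cpw_eq_sum a)
  rw [h]
  refine Differentiable.fun_sum fun x _ => Differentiable.smul_const ?_ _
  split_ifs with hx
  · exact differentiable_const _
  · exact fun z => (differentiableAt_id.const_cpow (Or.inl hx))

theorem cpw_zero_isSelfAdjoint {a : A} (ha : 0 ≤ a) : IsSelfAdjoint (cpw a 0) := by
  simpa using isSelfAdjoint_cpw ha 0

theorem cpw_zero_mul_self (a : A) : cpw a 0 * cpw a 0 = cpw a 0 := by
  rw [← cpw_add, add_zero]

theorem cpw_zero_isStarProjection {a : A} (ha : 0 ≤ a) : IsStarProjection (cpw a 0) :=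
  ⟨cpw_zero_mul_self a, cpw_zero_isSelfAdjoint ha⟩

theorem cpw_zero_le_one {a : A} (ha : 0 ≤ a) : cpw a 0 ≤ 1 :=
  (cpw_zero_isStarProjection ha).le_one

theorem cpw_mul_cpw_zero (a : A) (z : ℂ) : cpw a z * cpw a 0 = cpw a z := by
  rw [← cpw_add, add_zero]

/-- Imaginary powers are partial isometries whose initial projection is the support. -/
theorem star_cpw_mul_cpw {a : A} (ha : 0 ≤ a) {z : ℂ} (hz : z.re = 0) :
    star (cpw a z) * cpw a z = cpw a 0 := by
  rw [star_cpw ha, ← cpw_add]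
  congr 1
  apply Complex.ext <;> simp [hz]

theorem norm_le_one_of_star_mul_self_le_one {a : A} (h : star a * a ≤ 1) : ‖a‖ ≤ 1 := by
  have h1 := (CStarAlgebra.norm_le_one_iff_of_nonneg _ (star_mul_self_nonneg a)).2 h
  rw [CStarRing.norm_star_mul_self] at h1
  nlinarith [norm_nonneg a]

theorem star_mul_self_le_one {a : A} (h : ‖a‖ ≤ 1) : star a * a ≤ 1 := by
  rw [← CStarAlgebra.norm_le_one_iff_of_nonneg _ (star_mul_self_nonneg a),
    CStarRing.norm_star_mul_self]
  nlinarith [norm_nonneg a]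

theorem norm_cpw_le_one {a : A} (ha : 0 ≤ a) {z : ℂ} (hz : z.re = 0) : ‖cpw a z‖ ≤ 1 :=
  norm_le_one_of_star_mul_self_le_one (star_cpw_mul_cpw ha hz ▸ cpw_zero_le_one ha)

/-- The imaginary part of the exponent contributes a factor of norm at most 1, so compactness of the
range of real parts suffices. -/
theorem exists_norm_cpw_le {a : A} (ha : 0 ≤ a) (l u : ℝ) :
    ∃ C : ℝ, 0 ≤ C ∧ ∀ z : ℂ, l ≤ z.re → z.re ≤ u → ‖cpw a z‖ ≤ C := by
  have hc : Continuous fun r : ℝ => cpw a (r : ℂ) :=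
    (differentiable_cpw a).continuous.comp Complex.continuous_ofReal
  obtain ⟨C, hC⟩ := (isCompact_Icc (a := l) (b := u)).exists_bound_of_continuousOn hc.continuousOn
  refine ⟨max C 0, le_max_right _ _, fun z h1 h2 => ?_⟩
  have : cpw a z = cpw a (z.re : ℂ) * cpw a (z.im * Complex.I) := by
    rw [← cpw_add, Complex.re_add_im]
  rw [this]
  calc _ ≤ ‖cpw a (z.re : ℂ)‖ * ‖cpw a (z.im * Complex.I)‖ := norm_mul_le _ _
    _ ≤ ‖cpw a (z.re : ℂ)‖ * 1 := by
      gcongr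
      exact norm_cpw_le_one ha (by simp)
    _ ≤ _ := by rw [mul_one]; exact (hC _ ⟨h1, h2⟩).trans (le_max_left _ _)

end ComplexPower

/-! ### Faithful traces and their pairings -/

section Trace

variable {A : Type*} [CStarAlgebra A] [PartialOrder A] [StarOrderedRing A]
variable {B : Type*} [CStarAlgebra B] [PartialOrder B] [StarOrderedRing B]
variable {C : Type*} [CStarAlgebra C] [PartialOrder C] [StarOrderedRing C]

/-- A faithful positive tracial functional. -/
structure IsFaithfulTrace (τ : A →ₗ[ℂ] ℂ) : Prop where
  comm (a b : A) : τ (a * b) = τ (b * a)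
  map_star (a : A) : τ (star a) = starRingEnd ℂ (τ a)
  re_pos (a : A) (ha : a ≠ 0) : 0 < (τ (star a * a)).re

theorem exists_eq_star_mul_self {a : A} (ha : 0 ≤ a) : ∃ b, a = star b * b :=
  CStarAlgebra.nonneg_iff_eq_star_mul_self.1 ha

/-- The trace of a matrix over an algebra with a linear functional. -/
def matrixTrace {n : Type*} [Fintype n] (τ : A →ₗ[ℂ] ℂ) : CStarMatrix n n A →ₗ[ℂ] ℂ where
  toFun M := ∑ i, τ (M i i)
  map_add' M N := by simp [Finset.sum_add_distrib]
  map_smul' c M := by simp [Finset.mul_sum]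

theorem matrixTrace_apply {n : Type*} [Fintype n] (τ : A →ₗ[ℂ] ℂ) (M : CStarMatrix n n A) :
    matrixTrace τ M = ∑ i, τ (M i i) := rfl

namespace IsFaithfulTrace

variable {τ : A →ₗ[ℂ] ℂ} (hτ : IsFaithfulTrace τ)
include hτ

theorem re_star_mul_self_nonneg (a : A) : 0 ≤ (τ (star a * a)).re := by
  rcases eq_or_ne a 0 with rfl | h
  · simp
  · exact (hτ.re_pos a h).le

theorem eq_zero_of_re_star_mul_self {a : A} (h : (τ (star a * a)).re ≤ 0) : a = 0 := by
  by_contra h0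
  exact absurd (hτ.re_pos a h0) (not_lt.2 h)

theorem re_nonneg {a : A} (ha : 0 ≤ a) : 0 ≤ (τ a).re := by
  obtain ⟨b, rfl⟩ := CStarAlgebra.nonneg_iff_eq_star_mul_self.1 ha
  exact hτ.re_star_mul_self_nonneg b

theorem re_mono {a b : A} (h : a ≤ b) : (τ a).re ≤ (τ b).re := by
  have := hτ.re_nonneg (sub_nonneg.2 h)
  rw [map_sub, Complex.sub_re] at this
  linarith

theorem im_eq_zero {a : A} (ha : IsSelfAdjoint a) : (τ a).im = 0 := by
  have := hτ.map_star a
  rw [ha.star_eq] at this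
  exact Complex.conj_eq_iff_im.1 this.symm

theorem ofReal_re {a : A} (ha : IsSelfAdjoint a) : ((τ a).re : ℂ) = τ a :=
  Complex.ext (by simp) (by simp [hτ.im_eq_zero ha])

theorem eq_zero_of_re_eq_zero {a : A} (ha : 0 ≤ a) (h : (τ a).re = 0) : a = 0 := by
  obtain ⟨b, rfl⟩ := CStarAlgebra.nonneg_iff_eq_star_mul_self.1 ha
  simp [hτ.eq_zero_of_re_star_mul_self h.le]

theorem re_mul_nonneg {a b : A} (ha : 0 ≤ a) (hb : 0 ≤ b) : 0 ≤ (τ (a * b)).re := by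
  obtain ⟨c, rfl⟩ := CStarAlgebra.nonneg_iff_eq_star_mul_self.1 ha
  obtain ⟨d, rfl⟩ := CStarAlgebra.nonneg_iff_eq_star_mul_self.1 hb
  have h := hτ.re_star_mul_self_nonneg (c * star d)
  rw [star_mul, star_star, mul_assoc, hτ.comm] at h
  simpa only [mul_assoc] using h

theorem re_mul_le_re_mul_right {a b c : A} (hc : 0 ≤ c) (h : a ≤ b) :
    (τ (a * c)).re ≤ (τ (b * c)).re := by
  have := hτ.re_mul_nonneg (sub_nonneg.2 h) hc
  rw [sub_mul, map_sub, Complex.sub_re] at this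
  linarith

theorem re_mul_le_re_mul_left {a b c : A} (hc : 0 ≤ c) (h : a ≤ b) :
    (τ (c * a)).re ≤ (τ (c * b)).re := by
  rw [hτ.comm c a, hτ.comm c b]
  exact hτ.re_mul_le_re_mul_right hc h

/-- An element is determined by its pairings with all elements. -/
theorem ext_of_mul_left {a b : A} (h : ∀ c, τ (c * a) = τ (c * b)) : a = b := by
  rw [← sub_eq_zero]
  apply hτ.eq_zero_of_re_star_mul_self
  rw [mul_sub, map_sub, h, sub_self, Complex.zero_re]

/-- A selfadjoint element that pairs nonnegatively with all nonnegative elements is nonnegative. -/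
theorem nonneg_of_forall_re_mul_nonneg {b : A} (hb : IsSelfAdjoint b)
    (h : ∀ a, 0 ≤ a → 0 ≤ (τ (a * b)).re) : 0 ≤ b := by
  have h1 := h (b⁻) (CFC.negPart_nonneg b)
  have hd : b = b⁺ - b⁻ := (CFC.posPart_sub_negPart b hb).symm
  have h2 : b⁻ * b = -(star (b⁻) * b⁻) := by
    rw [(IsSelfAdjoint.of_nonneg (CFC.negPart_nonneg b)).star_eq]
    nth_rewrite 2 [← CFC.posPart_sub_negPart b hb]
    rw [mul_sub, CFC.negPart_mul_posPart, zero_sub]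
  rw [h2, map_neg, Complex.neg_re] at h1
  have h3 : b⁻ = 0 := hτ.eq_zero_of_re_star_mul_self (by linarith)
  rw [hd, h3, sub_zero]
  exact CFC.posPart_nonneg b

/-- The trace of a matrix over an algebra with a trace. -/
theorem cstarMatrix {n : Type*} [Fintype n] [DecidableEq n] :
    IsFaithfulTrace (matrixTrace (n := n) τ) where
  comm M N := by
    simp only [matrixTrace_apply, CStarMatrix.mul_apply, map_sum]
    rw [Finset.sum_comm]
    exact Finset.sum_congr rfl fun _ _ => Finset.sum_congr rfl fun _ _ => hτ.comm _ _
  map_star M := by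
    simp [matrixTrace_apply, CStarMatrix.star_apply, hτ.map_star]
  re_pos M hM := by
    simp only [matrixTrace_apply, CStarMatrix.mul_apply, CStarMatrix.star_apply, map_sum,
      Complex.re_sum]
    obtain ⟨i, j, hij⟩ : ∃ i j, M i j ≠ 0 := by
      by_contra! h
      exact hM (CStarMatrix.ext h)
    refine Finset.sum_pos' (fun j _ => Finset.sum_nonneg fun i _ => hτ.re_star_mul_self_nonneg _)
      ⟨j, Finset.mem_univ _, Finset.sum_pos' (fun i _ => hτ.re_star_mul_self_nonneg _)
        ⟨i, Finset.mem_univ _, hτ.re_pos _ hij⟩⟩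

/-- The bilinear form of a faithful trace is nondegenerate. -/
theorem nondegenerate : ((LinearMap.mul ℂ A).compr₂ τ).Nondegenerate := by
  refine ⟨fun a h => ?_, fun a h => ?_⟩
  · have := h (star a)
    simp only [LinearMap.compr₂_apply, LinearMap.mul_apply'] at this
    rw [hτ.comm] at this
    exact hτ.eq_zero_of_re_star_mul_self (by rw [this]; simp)
  · have := h (star a)
    simp only [LinearMap.compr₂_apply, LinearMap.mul_apply'] at this
    exact hτ.eq_zero_of_re_star_mul_self (by rw [this]; simp)

/-- Existence of the adjoint of a linear map with respect to the trace pairings. -/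
theorem exists_adjoint [FiniteDimensional ℂ A] (τ' : B →ₗ[ℂ] ℂ) (Φ : A →ₗ[ℂ] B) :
    ∃ Φ' : B →ₗ[ℂ] A, ∀ a b, τ' (Φ a * b) = τ (a * Φ' b) := by
  let e := LinearMap.BilinForm.toDual ((LinearMap.mul ℂ A).compr₂ τ) hτ.nondegenerate
  let g : B →ₗ[ℂ] Module.Dual ℂ A :=
    (LinearMap.mul ℂ B).flip.compr₂ τ' |>.compl₂ Φ
  refine ⟨e.symm.toLinearMap ∘ₗ g, fun a b => ?_⟩
  have : e (e.symm (g b)) a = g b a := by rw [LinearEquiv.apply_symm_apply]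
  rw [LinearMap.BilinForm.toDual_def] at this
  simp only [LinearMap.compr₂_apply, LinearMap.mul_apply', LinearMap.compl₂_apply,
    LinearMap.flip_apply, g] at this
  rw [LinearMap.comp_apply, hτ.comm, ← this]
  rfl

end IsFaithfulTrace

/-! ### Completely positive maps under the trace pairing -/

/-- Complete positivity of a linear map. -/
def IsCP (Φ : A →ₗ[ℂ] B) : Prop :=
  ∀ (k : ℕ) (M : CStarMatrix (Fin k) (Fin k) A), 0 ≤ M → 0 ≤ M.map Φ

theorem IsCP.add {Φ Ψ : A →ₗ[ℂ] B} (hΦ : IsCP Φ) (hΨ : IsCP Ψ) : IsCP (Φ + Ψ) :=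
  fun k M hM => add_nonneg (hΦ k M hM) (hΨ k M hM)

theorem IsCP.comp {Φ : A →ₗ[ℂ] B} {Ψ : B →ₗ[ℂ] C} (hΨ : IsCP Ψ) (hΦ : IsCP Φ) : IsCP (Ψ ∘ₗ Φ) :=
  fun k M hM => hΨ k _ (hΦ k M hM)

/-- Conjugation `a ↦ star c * a * c`. -/
def conjMap (c : A) : A →ₗ[ℂ] A := LinearMap.mulLeft ℂ (star c) ∘ₗ LinearMap.mulRight ℂ c

theorem conjMap_apply (c a : A) : conjMap c a = star c * (a * c) := rfl

theorem isCP_conjMap (c : A) : IsCP (conjMap c) := by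
  intro k M hM
  obtain ⟨N, rfl⟩ := exists_eq_star_mul_self hM
  have : (star N * N).map (conjMap c)
      = star (N.map (LinearMap.mulRight ℂ c)) * N.map (LinearMap.mulRight ℂ c) := by
    ext i j
    simp [CStarMatrix.mul_apply, CStarMatrix.star_apply, CStarMatrix.map_apply, conjMap_apply,
      mul_assoc]
  rw [this]
  exact star_mul_self_nonneg _

open scoped MatrixOrder in
/-- A positive functional times a projection is completely positive. -/
theorem isCP_smulRight (f : A →ₗ[ℂ] ℂ)
    (hfs : ∀ a, f (star a) = starRingEnd ℂ (f a)) (hf : ∀ a, 0 ≤ f (star a * a)) {q : B}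
    (hq : IsStarProjection q) : IsCP (f.smulRight q) := by
  intro k M hM
  obtain ⟨N, rfl⟩ := exists_eq_star_mul_self hM
  -- The scalar matrix of values of `f` is positive semidefinite, so it factors as `star c * c`;
  -- tensoring `c` with `q` factors the image matrix.
  let m : Matrix (Fin k) (Fin k) ℂ := Matrix.of fun i j => f ((star N * N) i j)
  have hstar (z : Fin k → ℂ) : star z ⬝ᵥ m.mulVec z
      = ∑ l, f (star (∑ j, z j • N l j) * ∑ j, z j • N l j) := by
    simp only [dotProduct, Matrix.mulVec, m, Matrix.of_apply, CStarMatrix.mul_apply,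
      CStarMatrix.star_apply, map_sum, star_sum, Finset.sum_mul, Finset.mul_sum, star_smul,
      smul_mul_assoc, mul_smul_comm, map_smul, smul_eq_mul, Pi.star_apply]
    rw [Finset.sum_comm_cycle]
    refine Finset.sum_congr rfl fun l _ => ?_
    rw [Finset.sum_comm]
    exact Finset.sum_congr rfl fun _ _ => Finset.sum_congr rfl fun _ _ => by ring
  have hm : m.PosSemidef := by
    refine Matrix.PosSemidef.of_dotProduct_mulVec_nonneg ?_ fun z => ?_
    · ext i j
      rw [Matrix.conjTranspose_apply]
      change star (f ((star N * N) j i)) = f ((star N * N) i j)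
      rw [Complex.star_def, ← hfs, ← CStarMatrix.star_apply,
        (IsSelfAdjoint.star_mul_self N).star_eq]
    · rw [hstar]
      exact Finset.sum_nonneg fun l _ => hf _
  obtain ⟨c, hc⟩ := CStarAlgebra.nonneg_iff_eq_star_mul_self.1 hm.nonneg
  let D : CStarMatrix (Fin k) (Fin k) B := CStarMatrix.ofMatrix fun i j => c i j • q
  have : (star N * N).map (f.smulRight q) = star D * D := by
    ext i j
    have h1 : f ((star N * N) i j) = ∑ l, star (c l i) * c l j := by
      have := congrFun (congrFun hc i) j
      simpa [m, Matrix.mul_apply] using this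
    rw [CStarMatrix.map_apply, LinearMap.smulRight_apply, h1]
    have hD (x y) : D x y = c x y • q := rfl
    simp [hD, CStarMatrix.mul_apply, CStarMatrix.star_apply, Finset.sum_smul,
      hq.isSelfAdjoint.star_eq, hq.isIdempotentElem.eq, smul_smul, mul_comm]
  rw [this]
  exact star_mul_self_nonneg _

variable {τ : A →ₗ[ℂ] ℂ} {τ' : B →ₗ[ℂ] ℂ}

theorem IsCP.nonneg {Φ : A →ₗ[ℂ] B} (hΦ : IsCP Φ) {a : A} (ha : 0 ≤ a) : 0 ≤ Φ a := by
  let Φ' : A →CP B := ⟨Φ, hΦ⟩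
  exact map_nonneg Φ' ha

theorem IsCP.mono {Φ : A →ₗ[ℂ] B} (hΦ : IsCP Φ) {a b : A} (h : a ≤ b) : Φ a ≤ Φ b := by
  rw [← sub_nonneg, ← map_sub]
  exact hΦ.nonneg (sub_nonneg.2 h)

theorem IsCP.map_star {Φ : A →ₗ[ℂ] B} (hΦ : IsCP Φ) (a : A) : Φ (star a) = star (Φ a) := by
  obtain ⟨y, hy, -, rfl⟩ := CStarAlgebra.exists_sum_four_nonneg a
  simp only [star_sum, star_smul, map_sum, map_smul]
  exact Finset.sum_congr rfl fun i _ => by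
    rw [(IsSelfAdjoint.of_nonneg (hy i)).star_eq,
      (IsSelfAdjoint.of_nonneg (hΦ.nonneg (hy i))).star_eq]

/-- The adjoint of a completely positive map is completely positive. -/
theorem IsCP.adjoint (hτ : IsFaithfulTrace τ) (hτ' : IsFaithfulTrace τ') {Φ : A →ₗ[ℂ] B}
    (hΦ : IsCP Φ) {Φ' : B →ₗ[ℂ] A} (h : ∀ a b, τ' (Φ a * b) = τ (a * Φ' b)) : IsCP Φ' := by
  have hstar : ∀ b, Φ' (star b) = star (Φ' b) := fun b => by
    refine hτ.ext_of_mul_left fun c => ?_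
    rw [← h, ← star_star c, hΦ.map_star, ← star_mul, hτ'.map_star, hτ'.comm, h, ← star_mul,
      hτ.map_star, hτ.comm (Φ' b)]
  intro k M hM
  -- The positive cone is self-dual for the matrix trace, so positivity of the amplified adjoint is
  -- tested against positive `N` and moved onto `Φ`.
  refine (hτ.cstarMatrix (n := Fin k)).nonneg_of_forall_re_mul_nonneg ?_ fun N hN => ?_
  · ext i j
    rw [CStarMatrix.star_apply, CStarMatrix.map_apply, CStarMatrix.map_apply, ← hstar,
      CStarMatrix.star_apply_of_isSelfAdjoint (IsSelfAdjoint.of_nonneg hM)]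
  · have h1 := (hτ'.cstarMatrix (n := Fin k)).re_mul_nonneg (hΦ k N hN) hM
    simpa [matrixTrace_apply, CStarMatrix.mul_apply, h] using h1

/-- Cauchy–Schwarz type estimate for completely positive maps under the trace pairing. -/
theorem IsCP.re_pairing_nonneg (hτ' : IsFaithfulTrace τ') {Φ : A →ₗ[ℂ] B}
    (hΦ : IsCP Φ) (a b : A) (c d : B) :
    0 ≤ (τ' (Φ (star a * a) * (star c * c))).re + 2 * (τ' (Φ (star a * b) * (star d * c))).re
      + (τ' (Φ (star b * b) * (star d * d))).re := by
  -- With a single nonzero row, `star M * M` is the Gram matrix of `a, b`; likewise for `N` and `c,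
  -- d`. Pairing the two produces the four terms.
  let M : CStarMatrix (Fin 2) (Fin 2) A := CStarMatrix.ofMatrix !![a, b; 0, 0]
  let N : CStarMatrix (Fin 2) (Fin 2) B := CStarMatrix.ofMatrix !![c, d; 0, 0]
  have h := (hτ'.cstarMatrix (n := Fin 2)).re_mul_nonneg (hΦ 2 _ (star_mul_self_nonneg M))
    (star_mul_self_nonneg N)
  have h2 : (τ' (Φ (star b * a) * (star c * d))).re = (τ' (Φ (star a * b) * (star d * c))).re := by
    have h3 : star (Φ (star a * b) * (star d * c)) = (star c * d) * Φ (star b * a) := by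
      rw [star_mul, ← hΦ.map_star]
      simp
    rw [hτ'.comm, ← h3, hτ'.map_star, Complex.conj_re]
  simp [matrixTrace_apply, CStarMatrix.mul_apply, CStarMatrix.star_apply, Fin.sum_univ_two, M, N,
    h2] at h
  linarith

theorem IsCP.norm_pairing_le (hτ' : IsFaithfulTrace τ') {Φ : A →ₗ[ℂ] B}
    (hΦ : IsCP Φ) (a b : A) (c d : B) :
    2 * ‖τ' (Φ (star a * b) * (star d * c))‖ ≤ (τ' (Φ (star a * a) * (star c * c))).re
      + (τ' (Φ (star b * b) * (star d * d))).re := by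
  set w := τ' (Φ (star a * b) * (star d * c)) with hw
  rcases eq_or_ne w 0 with h0 | h0
  · have h1 := hΦ.re_pairing_nonneg hτ' a b c d
    rw [← hw, h0] at h1
    rw [h0]
    simpa using h1
  -- Multiplying `b` by this phase turns the cross term into `-‖w‖` and leaves `star b * b`
  -- unchanged.
  · let u : ℂ := -(starRingEnd ℂ w / ‖w‖)
    have hu : starRingEnd ℂ u * u = 1 := by
      rw [← Complex.normSq_eq_conj_mul_self, Complex.normSq_eq_norm_sq]
      simp [u, h0]
    have h1 := hΦ.re_pairing_nonneg hτ' a (u • b) c d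
    have h2 : u * w = -(‖w‖ : ℂ) := by
      have : (‖w‖ : ℂ) ≠ 0 := by simpa using h0
      have h3 : starRingEnd ℂ w * w = (‖w‖ : ℂ) ^ 2 := Complex.conj_mul' w
      simp only [u]
      rw [neg_mul, div_mul_eq_mul_div, h3]
      field_simp
    have h4 : star (u • b) * (u • b) = star b * b := by
      rw [star_smul, smul_mul_smul_comm, Complex.star_def, hu, one_smul]
    rw [h4, mul_smul_comm, map_smul, smul_mul_assoc, map_smul, smul_eq_mul, ← hw, h2] at h1
    simp at h1
    linarith

end Trace

/-! ### Fixed points of symmetric positive maps -/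

section FixedPoint

variable {A : Type*} [CStarAlgebra A] [PartialOrder A] [StarOrderedRing A]
variable {τ : A →ₗ[ℂ] ℂ}

theorem IsFaithfulTrace.re_star_mul_comm (hτ : IsFaithfulTrace τ) (x y : A) :
    (τ (star x * y)).re = (τ (star y * x)).re := by
  have h := hτ.map_star (star x * y)
  rw [star_mul, star_star] at h
  rw [h, Complex.conj_re]

theorem IsFaithfulTrace.re_star_sub_mul_sub (hτ : IsFaithfulTrace τ) (x y : A) :
    (τ (star (x - y) * (x - y))).re
      = (τ (star x * x)).re + (τ (star y * y)).re - 2 * (τ (star x * y)).re := by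
  have h := hτ.re_star_mul_comm x y
  simp only [star_sub, sub_mul, mul_sub, map_sub, Complex.sub_re]
  linarith

/-- The iterates of a positive map which fixes `e` and maps `1` below a multiple of `e`
are bounded. -/
theorem exists_norm_iterate_le {T : A →ₗ[ℂ] A} (hT : ∀ a, 0 ≤ a → 0 ≤ T a) {e : A}
    (he : T e = e) {c : ℝ} (hc : T 1 ≤ c • e) (a : A) :
    ∃ C : ℝ, ∀ k : ℕ, ‖(T ^ (k + 1)) a‖ ≤ C := by
  have hmono : ∀ x y, x ≤ y → T x ≤ T y := fun x y h => by
    rw [← sub_nonneg, ← map_sub]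
    exact hT _ (sub_nonneg.2 h)
  have hce : T (c • e) = c • e := by
    rw [← Complex.coe_smul, map_smul, he]
  have hpos : ∀ k : ℕ, ∀ x, 0 ≤ x → 0 ≤ (T ^ k) x := by
    intro k
    induction k with
    | zero => intro x hx; simpa using hx
    | succ k ih => intro x hx; rw [pow_succ']; exact hT _ (ih x hx)
  -- The domination by `c • e` starts only after one application of `T`, hence the exponent `k + 1`.
  have hone : ∀ k : ℕ, (T ^ (k + 1)) 1 ≤ c • e := by
    intro k
    induction k with
    | zero => simpa using hc
    | succ k ih => rw [pow_succ', ← hce]; exact hmono _ _ ih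
  have hnn : ∀ k : ℕ, ∀ x, 0 ≤ x → ‖(T ^ (k + 1)) x‖ ≤ ‖c • e‖ * ‖x‖ := by
    intro k x hx
    let f : A →ₚ[ℂ] A := PositiveLinearMap.mk₀ (T ^ (k + 1)) (hpos (k + 1))
    have h1 : ‖(T ^ (k + 1)) x‖ ≤ ‖(T ^ (k + 1)) 1‖ * ‖x‖ := f.norm_apply_le_of_nonneg x hx
    refine h1.trans ?_
    gcongr
    exact CStarAlgebra.norm_le_norm_of_nonneg_of_le (hpos _ _ zero_le_one) (hone k)
  obtain ⟨y, hy, -, rfl⟩ := CStarAlgebra.exists_sum_four_nonneg a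
  refine ⟨∑ i : Fin 4, ‖c • e‖ * ‖y i‖, fun k => ?_⟩
  rw [map_sum]
  refine (norm_sum_le _ _).trans (Finset.sum_le_sum fun i _ => ?_)
  rw [map_smul, norm_smul, norm_pow, Complex.norm_I, one_pow, one_mul]
  exact hnn k _ (hy i)

/-- A positive map which is symmetric for the trace form and fixes `e`, with `T 1` below a multiple
of `e`, is a contraction, and fixes every element whose quadratic form is not decreased. -/
theorem IsFaithfulTrace.eq_of_le_quadratic_form [FiniteDimensional ℂ A] (hτ : IsFaithfulTrace τ)
    {T : A →ₗ[ℂ] A} (hT : ∀ a, 0 ≤ a → 0 ≤ T a)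
    (hsym : ∀ a b, τ (star (T a) * b) = τ (star a * T b)) {e : A}
    (he : T e = e) {c : ℝ} (hc : T 1 ≤ c • e) {a : A}
    (ha : (τ (star a * a)).re ≤ (τ (star a * T a)).re) : T a = a := by
  -- By symmetry of `T` the squared norms of the iterates form a convex sequence. Being bounded, it
  -- cannot have a positive first increment, and that increment dominates the squared norm of `T a -
  -- a`.
  let b : ℕ → ℝ := fun k => (τ (star ((T ^ k) a) * (T ^ k) a)).re
  have hconv : ∀ k, 2 * b (k + 1) ≤ b (k + 2) + b k := by
    intro k
    have h1 := hτ.re_star_mul_self_nonneg ((T ^ (k + 2)) a - (T ^ k) a)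
    have h2 : τ (star ((T ^ (k + 2)) a) * (T ^ k) a)
        = τ (star ((T ^ (k + 1)) a) * (T ^ (k + 1)) a) := by
      have h3 : (T ^ (k + 2)) a = T ((T ^ (k + 1)) a) := by rw [pow_succ' T (k + 1)]; rfl
      have h4 : (T ^ (k + 1)) a = T ((T ^ k) a) := by rw [pow_succ']; rfl
      rw [h3, hsym, ← h4]
    rw [hτ.re_star_sub_mul_sub, h2] at h1
    simp only [b]
    linarith
  have hd : (τ (star (T a - a) * (T a - a))).re ≤ b 1 - b 0 := by
    rw [hτ.re_star_sub_mul_sub, hτ.re_star_mul_comm (T a) a]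
    simp only [b, pow_one, pow_zero, Module.End.one_apply]
    linarith
  have hinc : ∀ k, b 1 - b 0 ≤ b (k + 1) - b k := by
    intro k
    induction k with
    | zero => exact le_rfl
    | succ k ih => have := hconv k; linarith
  have hlin : ∀ k : ℕ, b 0 + k * (b 1 - b 0) ≤ b k := by
    intro k
    induction k with
    | zero => simp
    | succ k ih => have := hinc k; push_cast; linarith
  obtain ⟨C, hC⟩ := exists_norm_iterate_le hT he hc a
  let τc := LinearMap.toContinuousLinearMap τ
  have hbd : ∀ k, b (k + 1) ≤ ‖τc‖ * (C * C) := by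
    intro k
    calc b (k + 1) ≤ ‖τ (star ((T ^ (k + 1)) a) * (T ^ (k + 1)) a)‖ := Complex.re_le_norm _
      _ ≤ ‖τc‖ * ‖star ((T ^ (k + 1)) a) * (T ^ (k + 1)) a‖ := τc.le_opNorm _
      _ ≤ ‖τc‖ * (C * C) := by
        rw [CStarRing.norm_star_mul_self]
        have := hC k
        have := (norm_nonneg _).trans this
        gcongr
  have hle : b 1 - b 0 ≤ 0 := by
    by_contra! hpos
    obtain ⟨n, hn⟩ := exists_nat_gt ((‖τc‖ * (C * C) - b 0) / (b 1 - b 0))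
    rw [div_lt_iff₀ hpos] at hn
    have h1 := hlin (n + 1)
    have h2 := hbd n
    push_cast at h1
    linarith
  exact sub_eq_zero.1 (hτ.eq_zero_of_re_star_mul_self (hd.trans hle))

end FixedPoint

/-! ### Holomorphic families and edge estimates -/

section Interpolation

variable {A : Type*} [CStarAlgebra A] [PartialOrder A] [StarOrderedRing A]
  [FiniteDimensional ℂ A]
variable {B : Type*} [CStarAlgebra B] [PartialOrder B] [StarOrderedRing B]
  [FiniteDimensional ℂ B]
variable {τ : A →ₗ[ℂ] ℂ} {τ' : B →ₗ[ℂ] ℂ}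

theorem star_cpw_mul_cpw_self {a : A} (ha : 0 ≤ a) (z : ℂ) :
    star (cpw a z) * cpw a z = cpw a ((2 * z.re : ℝ) : ℂ) := by
  rw [star_cpw ha, ← cpw_add]
  congr 1
  apply Complex.ext <;> simp; ring

theorem mul_star_self_le_one {a : A} (h : ‖a‖ ≤ 1) : a * star a ≤ 1 := by
  have := star_mul_self_le_one (a := star a) (by rwa [norm_star])
  rwa [star_star] at this

/-- Multiplying by a contraction on the left does not increase the trace norm of the square. -/
theorem IsFaithfulTrace.re_contraction_mul_le (hτ : IsFaithfulTrace τ) {u : A} (hu : ‖u‖ ≤ 1)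
    (a : A) : (τ (star (u * a) * (u * a))).re ≤ (τ (star a * a)).re := by
  have h := star_left_conjugate_le_conjugate (star_mul_self_le_one hu) a
  rw [mul_one] at h
  simpa only [star_mul, mul_assoc] using hτ.re_mono h

/-- Multiplying by a contraction on the right does not increase the trace norm of the square. -/
theorem IsFaithfulTrace.re_mul_contraction_le (hτ : IsFaithfulTrace τ) {u : A} (hu : ‖u‖ ≤ 1)
    (a : A) : (τ (star (a * u) * (a * u))).re ≤ (τ (star a * a)).re := by
  have h := hτ.re_mul_le_re_mul_left (star_mul_self_nonneg a) (mul_star_self_le_one hu)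
  rw [mul_one] at h
  rwa [star_mul, mul_assoc, hτ.comm, mul_assoc, mul_assoc, ← mul_assoc (star a)]

theorem IsFaithfulTrace.re_cpw_mul_contraction_le (hτ : IsFaithfulTrace τ) {x : A} (hx : 0 ≤ x)
    {z : ℂ} {r : ℝ} (hz : 2 * z.re = r) {u : A} (hu : ‖u‖ ≤ 1) :
    (τ (star (cpw x z * u) * (cpw x z * u))).re ≤ (τ (cpw x r)).re := by
  have h := hτ.re_mul_contraction_le hu (cpw x z)
  rwa [star_cpw_mul_cpw_self hx, hz] at h

/-- The trace-norm edge estimate. -/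
theorem IsCP.norm_trace_mul_contraction_le (hτ' : IsFaithfulTrace τ') {Φ : A →ₗ[ℂ] B}
    (hΦ : IsCP Φ) (htr : ∀ a, τ' (Φ a) = τ a) (a b : A) {g : B} (hg : ‖g‖ ≤ 1) :
    2 * ‖τ' (Φ (star a * b) * g)‖ ≤ (τ (star a * a)).re + (τ (star b * b)).re := by
  have h := hΦ.norm_pairing_le hτ' a b 1 (star g)
  have h1 := hτ'.re_mul_le_re_mul_left (hΦ.nonneg (star_mul_self_nonneg b))
    (mul_star_self_le_one hg)
  simp only [star_star, star_one, mul_one, htr] at h h1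
  linarith

/-- The operator-norm edge estimate. -/
theorem IsCP.norm_trace_contraction_mul_le (hτ' : IsFaithfulTrace τ') {Φ : A →ₗ[ℂ] B}
    (hΦ : IsCP Φ) {s : A} (hs : IsSelfAdjoint s) {s' : B} (hs' : IsSelfAdjoint s')
    (hss : Φ (s * s) = s' * s') {w : A} (hw : ‖w‖ ≤ 1) (c d : B) :
    2 * ‖τ' (Φ (s * w * s) * (star d * c))‖
      ≤ (τ' (star (c * s') * (c * s'))).re + (τ' (star (d * s') * (d * s'))).re := by
  -- Writing `s * w * s` as `star s * (w * s)` leaves two squares, both at most `s * s`, whose image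
  -- is `s' * s'`.
  have h := hΦ.norm_pairing_le hτ' s (w * s) c d
  have h1 : star (w * s) * (w * s) ≤ s * s := by
    have := star_left_conjugate_le_conjugate (star_mul_self_le_one hw) s
    rw [mul_one, hs.star_eq] at this
    rwa [star_mul, hs.star_eq, mul_assoc, ← mul_assoc (star w), ← mul_assoc]
  have h2 := hτ'.re_mul_le_re_mul_right (star_mul_self_nonneg d) (hΦ.mono h1)
  have h3 : ∀ x : B, τ' (Φ (s * s) * (star x * x)) = τ' (star (x * s') * (x * s')) := fun x => by
    rw [hss, star_mul, hs'.star_eq, hτ'.comm, ← mul_assoc, hτ'.comm, ← mul_assoc, ← mul_assoc,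
      ← mul_assoc]
  rw [hs.star_eq, h3, ← mul_assoc s w s] at h
  rw [h3] at h2
  linarith

/-- The holomorphic family through `cpw σ (1 / 2) * cpw x 0 * cpw σ (1 / 2)` and `cpw x α`. -/
def family (α : ℝ) (σ x : A) (z : ℂ) : A :=
  cpw σ ((1 - z) / 2) * cpw x (α * z) * cpw σ ((1 - z) / 2)

/-- The dual holomorphic family. -/
def dualFamily (α : ℝ) (σ x : A) (z : ℂ) : A :=
  cpw σ (-((1 - z) / 2)) * cpw x (α * (1 - z)) * cpw σ (-((1 - z) / 2))

theorem differentiable_family (α : ℝ) (σ x : A) : Differentiable ℂ (family α σ x) := by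
  have h1 : Differentiable ℂ fun z : ℂ => cpw σ ((1 - z) / 2) :=
    (differentiable_cpw σ).comp (by fun_prop)
  have h2 : Differentiable ℂ fun z : ℂ => cpw x (α * z) :=
    (differentiable_cpw x).comp (by fun_prop)
  exact (h1.mul h2).mul h1

theorem differentiable_dualFamily (α : ℝ) (σ x : A) : Differentiable ℂ (dualFamily α σ x) := by
  have h1 : Differentiable ℂ fun z : ℂ => cpw σ (-((1 - z) / 2)) :=
    (differentiable_cpw σ).comp (by fun_prop)
  have h2 : Differentiable ℂ fun z : ℂ => cpw x (α * (1 - z)) :=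
    (differentiable_cpw x).comp (by fun_prop)
  exact (h1.mul h2).mul h1

theorem norm_mul_mul_le {a b c : A} {r s : ℝ} (ha : ‖a‖ ≤ r) (hb : ‖b‖ ≤ s) (hc : ‖c‖ ≤ r) :
    ‖a * b * c‖ ≤ r * s * r := by
  have hr := (norm_nonneg _).trans ha
  have hs := (norm_nonneg _).trans hb
  calc ‖a * b * c‖ ≤ ‖a‖ * ‖b‖ * ‖c‖ := norm_mul₃_le
    _ ≤ r * s * r := by gcongr

theorem exists_norm_family_le {α : ℝ} (hα : 0 ≤ α) {σ x : A} (hσ : 0 ≤ σ) (hx : 0 ≤ x) :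
    ∃ C : ℝ, ∀ z : ℂ, 0 ≤ z.re → z.re ≤ 1 → ‖family α σ x z‖ ≤ C := by
  obtain ⟨C₁, -, h₁⟩ := exists_norm_cpw_le hσ 0 1
  obtain ⟨C₂, -, h₂⟩ := exists_norm_cpw_le hx 0 α
  refine ⟨C₁ * C₂ * C₁, fun z h0 h1 => norm_mul_mul_le (h₁ _ ?_ ?_) (h₂ _ ?_ ?_) (h₁ _ ?_ ?_)⟩ <;>
    simp <;> nlinarith

theorem exists_norm_dualFamily_le {α : ℝ} (hα : 0 ≤ α) {σ x : A} (hσ : 0 ≤ σ) (hx : 0 ≤ x) :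
    ∃ C : ℝ, ∀ z : ℂ, 0 ≤ z.re → z.re ≤ 1 → ‖dualFamily α σ x z‖ ≤ C := by
  obtain ⟨C₁, -, h₁⟩ := exists_norm_cpw_le hσ (-1) 0
  obtain ⟨C₂, -, h₂⟩ := exists_norm_cpw_le hx 0 α
  refine ⟨C₁ * C₂ * C₁, fun z h0 h1 => norm_mul_mul_le (h₁ _ ?_ ?_) (h₂ _ ?_ ?_) (h₁ _ ?_ ?_)⟩ <;>
    simp <;> nlinarith

/-- The pairing of the two families through `Φ`. -/
def pairing (τ' : B →ₗ[ℂ] ℂ) (Φ : A →ₗ[ℂ] B) (α : ℝ) (σ x : A) (y : B) (z : ℂ) : ℂ :=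
  τ' (Φ (family α σ x z) * dualFamily α (Φ σ) y z)

theorem differentiable_pairing (Φ : A →ₗ[ℂ] B) (α : ℝ) (σ x : A) (y : B) :
    Differentiable ℂ (pairing τ' Φ α σ x y) := by
  have h1 : Differentiable ℂ fun z => Φ (family α σ x z) :=
    (LinearMap.toContinuousLinearMap Φ).differentiable.comp (differentiable_family α σ x)
  exact (LinearMap.toContinuousLinearMap τ').differentiable.comp
    (h1.mul (differentiable_dualFamily α (Φ σ) y))

theorem bddAbove_pairing (Φ : A →ₗ[ℂ] B) {α : ℝ} (hα : 0 ≤ α) {σ x : A} {y : B} (hσ : 0 ≤ σ)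
    (hσ' : 0 ≤ Φ σ) (hx : 0 ≤ x) (hy : 0 ≤ y) :
    BddAbove ((norm ∘ pairing τ' Φ α σ x y) ''
      Complex.HadamardThreeLines.verticalClosedStrip 0 1) := by
  obtain ⟨C₁, h₁⟩ := exists_norm_family_le hα hσ hx
  obtain ⟨C₂, h₂⟩ := exists_norm_dualFamily_le hα hσ' hy
  let Φc := LinearMap.toContinuousLinearMap Φ
  let τc := LinearMap.toContinuousLinearMap τ'
  refine ⟨‖τc‖ * ((‖Φc‖ * C₁) * C₂), ?_⟩
  rintro _ ⟨z, hz, rfl⟩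
  have hf := h₁ z hz.1 hz.2
  have hg := h₂ z hz.1 hz.2
  have hC₁ := (norm_nonneg _).trans hf
  calc ‖τc (Φ (family α σ x z) * dualFamily α (Φ σ) y z)‖
      ≤ ‖τc‖ * ‖Φ (family α σ x z) * dualFamily α (Φ σ) y z‖ := τc.le_opNorm _
    _ ≤ ‖τc‖ * (‖Φc (family α σ x z)‖ * ‖dualFamily α (Φ σ) y z‖) := by
      gcongr
      exact norm_mul_le _ _
    _ ≤ ‖τc‖ * ((‖Φc‖ * ‖family α σ x z‖) * ‖dualFamily α (Φ σ) y z‖) := by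
      gcongr
      exact Φc.le_opNorm _
    _ ≤ _ := by gcongr

theorem norm_pairing_le_of_re_eq_one (hτ : IsFaithfulTrace τ) (hτ' : IsFaithfulTrace τ')
    {Φ : A →ₗ[ℂ] B} (hΦ : IsCP Φ) (htr : ∀ a, τ' (Φ a) = τ a) (α : ℝ) {σ x : A} {y : B}
    (hσ : 0 ≤ σ) (hx : 0 ≤ x) (hy : 0 ≤ y) {z : ℂ} (hz : z.re = 1) :
    ‖pairing τ' Φ α σ x y z‖ ≤ (τ (cpw x α)).re := by
  have hu : ‖cpw σ ((1 - z) / 2)‖ ≤ 1 := norm_cpw_le_one hσ (by simp [hz])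
  have hg : ‖dualFamily α (Φ σ) y z‖ ≤ 1 := by
    refine (norm_mul_mul_le (r := 1) (s := 1) ?_ ?_ ?_).trans_eq (by norm_num)
    · exact norm_cpw_le_one (hΦ.nonneg hσ) (by simp [hz])
    · exact norm_cpw_le_one hy (by simp [hz])
    · exact norm_cpw_le_one (hΦ.nonneg hσ) (by simp [hz])
  -- The middle power is split into exponents `α / 2` and `α * z - α / 2`, both of real part `α / 2`
  -- on this edge; each square then has trace at most that of `cpw x α`.
  have h := hΦ.norm_trace_mul_contraction_le hτ' htr
    (cpw x ((α / 2 : ℝ) : ℂ) * star (cpw σ ((1 - z) / 2)))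
    (cpw x (α * z - (α / 2 : ℝ)) * cpw σ ((1 - z) / 2)) hg
  have hf : star (cpw x ((α / 2 : ℝ) : ℂ) * star (cpw σ ((1 - z) / 2)))
      * (cpw x (α * z - (α / 2 : ℝ)) * cpw σ ((1 - z) / 2)) = family α σ x z := by
    rw [star_mul, star_star, (isSelfAdjoint_cpw hx _).star_eq, family, mul_assoc,
      ← mul_assoc (cpw x _) (cpw x _), ← cpw_add, ← mul_assoc, add_sub_cancel]
  rw [hf] at h
  have h1 := hτ.re_cpw_mul_contraction_le hx (z := ((α / 2 : ℝ) : ℂ)) (r := α)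
    (by simp; ring) (u := star (cpw σ ((1 - z) / 2))) (by rwa [norm_star])
  have h2 := hτ.re_cpw_mul_contraction_le hx (z := α * z - (α / 2 : ℝ)) (r := α)
    (by simp [hz]; ring) hu
  rw [pairing]
  linarith

theorem cpw_half_mul_self {σ : A} (hσ : 0 ≤ σ) :
    cpw σ ((1 / 2 : ℝ) : ℂ) * cpw σ ((1 / 2 : ℝ) : ℂ) = σ := by
  rw [← cpw_add]
  conv_rhs => rw [← cpw_one hσ]
  congr 1
  push_cast
  ring

/-- On this edge the first family is σ^(1/2) w σ^(1/2) with `w` a contraction. After `Φ`, the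
resulting square roots of `Φ σ` cancel the exponents of real part -1/2 in the dual family, up to
contractions. -/
theorem norm_pairing_le_of_re_eq_zero (hτ' : IsFaithfulTrace τ')
    {Φ : A →ₗ[ℂ] B} (hΦ : IsCP Φ) (α : ℝ) {σ x : A} {y : B}
    (hσ : 0 ≤ σ) (hx : 0 ≤ x) (hy : 0 ≤ y) {z : ℂ} (hz : z.re = 0) :
    ‖pairing τ' Φ α σ x y z‖ ≤ (τ' (cpw y α)).re := by
  have hσ' := hΦ.nonneg hσ
  have hw : ‖cpw σ (-z / 2) * cpw x (α * z) * cpw σ (-z / 2)‖ ≤ 1 := by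
    refine (norm_mul_mul_le (r := 1) (s := 1) ?_ ?_ ?_).trans_eq (by norm_num)
    · exact norm_cpw_le_one hσ (by simp [hz])
    · exact norm_cpw_le_one hx (by simp [hz])
    · exact norm_cpw_le_one hσ (by simp [hz])
  have h := hΦ.norm_trace_contraction_mul_le hτ' (isSelfAdjoint_cpw hσ (1 / 2))
    (isSelfAdjoint_cpw hσ' (1 / 2)) (by rw [cpw_half_mul_self hσ, cpw_half_mul_self hσ']) hw
    (cpw y (α * (1 - z) - (α / 2 : ℝ)) * cpw (Φ σ) (-((1 - z) / 2)))
    (cpw y ((α / 2 : ℝ) : ℂ) * star (cpw (Φ σ) (-((1 - z) / 2))))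
  have hf : cpw σ ((1 / 2 : ℝ) : ℂ) * (cpw σ (-z / 2) * cpw x (α * z) * cpw σ (-z / 2))
      * cpw σ ((1 / 2 : ℝ) : ℂ) = family α σ x z := by
    have h3 : (1 - z) / 2 = ((1 / 2 : ℝ) : ℂ) + -z / 2 := by push_cast; ring
    have h4 : (1 - z) / 2 = -z / 2 + ((1 / 2 : ℝ) : ℂ) := by push_cast; ring
    rw [family]
    nth_rewrite 1 [h3]
    rw [h4, cpw_add, cpw_add]
    simp only [mul_assoc]
  have hg : star (cpw y ((α / 2 : ℝ) : ℂ) * star (cpw (Φ σ) (-((1 - z) / 2))))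
      * (cpw y (α * (1 - z) - (α / 2 : ℝ)) * cpw (Φ σ) (-((1 - z) / 2)))
      = dualFamily α (Φ σ) y z := by
    rw [star_mul, star_star, (isSelfAdjoint_cpw hy _).star_eq, dualFamily, mul_assoc,
      ← mul_assoc (cpw y _) (cpw y _), ← cpw_add, ← mul_assoc, add_sub_cancel]
  rw [hf, hg] at h
  have h1 := hτ'.re_cpw_mul_contraction_le hy (z := α * (1 - z) - (α / 2 : ℝ)) (r := α)
    (by simp [hz]; ring) (u := cpw (Φ σ) (-((1 - z) / 2)) * cpw (Φ σ) ((1 / 2 : ℝ) : ℂ))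
    (by rw [← cpw_add]; exact norm_cpw_le_one hσ' (by simp [hz]))
  have h2 := hτ'.re_cpw_mul_contraction_le hy (z := ((α / 2 : ℝ) : ℂ)) (r := α)
    (by simp; ring) (u := star (cpw (Φ σ) (-((1 - z) / 2))) * cpw (Φ σ) ((1 / 2 : ℝ) : ℂ))
    (by
      rw [star_cpw hσ', ← cpw_add]
      exact norm_cpw_le_one hσ' (by rw [Complex.add_re, Complex.conj_re]; simp [hz]))
  simp only [mul_assoc] at h h1 h2
  rw [pairing]
  linarith

end Interpolation

/-! ### Data processing and its equality case -/

section DataProcessing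

variable {A : Type*} [CStarAlgebra A] [PartialOrder A] [StarOrderedRing A]
  [FiniteDimensional ℂ A]
variable {B : Type*} [CStarAlgebra B] [PartialOrder B] [StarOrderedRing B]
  [FiniteDimensional ℂ B]
variable {τ : A →ₗ[ℂ] ℂ} {τ' : B →ₗ[ℂ] ℂ}

/-- The operator `σ ^ ((1 - α) / (2 α)) ρ σ ^ ((1 - α) / (2 α))`. -/
def sandwich (α : ℝ) (ρ σ : A) : A :=
  cpw σ (((1 - α) / (2 * α) : ℝ) : ℂ) * ρ * cpw σ (((1 - α) / (2 * α) : ℝ) : ℂ)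

theorem sandwich_nonneg (α : ℝ) {ρ σ : A} (hρ : 0 ≤ ρ) (hσ : 0 ≤ σ) : 0 ≤ sandwich α ρ σ := by
  have h := star_left_conjugate_nonneg hρ (cpw σ (((1 - α) / (2 * α) : ℝ) : ℂ))
  rwa [(isSelfAdjoint_cpw hσ _).star_eq] at h

/-- The sandwiched quantity `Tr[(σ ^ ((1 - α) / (2 α)) ρ σ ^ ((1 - α) / (2 α))) ^ α]`. -/
def sandwichedTrace (τ : A →ₗ[ℂ] ℂ) (α : ℝ) (ρ σ : A) : ℝ := (τ (cpw (sandwich α ρ σ) α)).re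

/-- At z = 1/α the outer exponent is (α - 1)/(2α), which undoes the sandwiching on the support of
`σ`. -/
theorem family_inv {α : ℝ} (hα : 1 < α) {ρ σ : A} (hρ : 0 ≤ ρ) (hσ : 0 ≤ σ)
    (hP : cpw σ 0 * ρ * cpw σ 0 = ρ) :
    family α σ (sandwich α ρ σ) ((α⁻¹ : ℝ) : ℂ) = ρ := by
  have hα0 : (α : ℂ) ≠ 0 := by
    norm_cast
    positivity
  have h1 : (1 - ((α⁻¹ : ℝ) : ℂ)) / 2 + (((1 - α) / (2 * α) : ℝ) : ℂ) = 0 := by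
    push_cast
    field_simp
    ring
  have h2 : (α : ℂ) * ((α⁻¹ : ℝ) : ℂ) = 1 := by
    push_cast
    field_simp
  have h3 : (((1 - α) / (2 * α) : ℝ) : ℂ) + (1 - ((α⁻¹ : ℝ) : ℂ)) / 2 = 0 := by
    rw [add_comm, h1]
  rw [family, h2, cpw_one (sandwich_nonneg α hρ hσ), sandwich]
  calc _ = (cpw σ ((1 - ((α⁻¹ : ℝ) : ℂ)) / 2) * cpw σ (((1 - α) / (2 * α) : ℝ) : ℂ)) * ρ *
        (cpw σ (((1 - α) / (2 * α) : ℝ) : ℂ) * cpw σ ((1 - ((α⁻¹ : ℝ) : ℂ)) / 2)) := by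
          simp only [mul_assoc]
    _ = ρ := by rw [← cpw_add, ← cpw_add, h1, h3, hP]

theorem pairing_inv (hτ' : IsFaithfulTrace τ') {Φ : A →ₗ[ℂ] B} (hΦ : IsCP Φ)
    {α : ℝ} (hα : 1 < α) {ρ σ : A} (hρ : 0 ≤ ρ) (hσ : 0 ≤ σ)
    (hP : cpw σ 0 * ρ * cpw σ 0 = ρ) :
    pairing τ' Φ α σ (sandwich α ρ σ) (sandwich α (Φ ρ) (Φ σ)) ((α⁻¹ : ℝ) : ℂ)
      = sandwichedTrace τ' α (Φ ρ) (Φ σ) := by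
  have hα0 : (α : ℂ) ≠ 0 := by
    norm_cast
    positivity
  have hy := sandwich_nonneg α (hΦ.nonneg hρ) (hΦ.nonneg hσ)
  have h1 : -((1 - ((α⁻¹ : ℝ) : ℂ)) / 2) = (((1 - α) / (2 * α) : ℝ) : ℂ) := by
    push_cast
    field_simp
    ring
  have h2 : (α : ℂ) * (1 - ((α⁻¹ : ℝ) : ℂ)) = (α - 1 : ℂ) := by
    push_cast
    field_simp
  rw [pairing, family_inv hα hρ hσ hP, dualFamily, h1, h2, sandwichedTrace,
    hτ'.ofReal_re (isSelfAdjoint_cpw hy α)]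
  have h3 : cpw (sandwich α (Φ ρ) (Φ σ)) α = sandwich α (Φ ρ) (Φ σ) *
      cpw (sandwich α (Φ ρ) (Φ σ)) (α - 1) := by
    nth_rewrite 2 [← cpw_one hy]
    rw [← cpw_add, add_sub_cancel]
  rw [h3]
  nth_rewrite 2 [sandwich]
  rw [← mul_assoc, hτ'.comm]
  simp only [mul_assoc]

theorem sandwichedTrace_nonneg (hτ : IsFaithfulTrace τ) (α : ℝ) {ρ σ : A} (hρ : 0 ≤ ρ)
    (hσ : 0 ≤ σ) : 0 ≤ sandwichedTrace τ α ρ σ :=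
  hτ.re_nonneg (cpw_nonneg (sandwich_nonneg α hρ hσ) α)

theorem norm_pairing_le (hτ : IsFaithfulTrace τ) (hτ' : IsFaithfulTrace τ')
    {Φ : A →ₗ[ℂ] B} (hΦ : IsCP Φ) (htr : ∀ a, τ' (Φ a) = τ a)
    {α : ℝ} (hα : 1 < α) {ρ σ : A} (hρ : 0 ≤ ρ) (hσ : 0 ≤ σ) {z : ℂ} (h0 : 0 ≤ z.re)
    (h1 : z.re ≤ 1) :
    ‖pairing τ' Φ α σ (sandwich α ρ σ) (sandwich α (Φ ρ) (Φ σ)) z‖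
      ≤ sandwichedTrace τ' α (Φ ρ) (Φ σ) ^ (1 - z.re) * sandwichedTrace τ α ρ σ ^ z.re := by
  have hx := sandwich_nonneg α hρ hσ
  have hy := sandwich_nonneg α (hΦ.nonneg hρ) (hΦ.nonneg hσ)
  exact Complex.HadamardThreeLines.norm_le_interp_of_mem_verticalClosedStrip₀₁' _ ⟨h0, h1⟩
    (differentiable_pairing Φ α σ _ _).diffContOnCl
    (bddAbove_pairing Φ (by linarith) hσ (hΦ.nonneg hσ) hx hy)
    (fun w hw => norm_pairing_le_of_re_eq_zero hτ' hΦ α hσ hx hy hw)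
    (fun w hw => norm_pairing_le_of_re_eq_one hτ hτ' hΦ htr α hσ hx hy hw)

/-- The data processing inequality for the sandwiched quantity. -/
theorem sandwichedTrace_le (hτ : IsFaithfulTrace τ) (hτ' : IsFaithfulTrace τ')
    {Φ : A →ₗ[ℂ] B} (hΦ : IsCP Φ) (htr : ∀ a, τ' (Φ a) = τ a)
    {α : ℝ} (hα : 1 < α) {ρ σ : A} (hρ : 0 ≤ ρ) (hσ : 0 ≤ σ)
    (hP : cpw σ 0 * ρ * cpw σ 0 = ρ) :
    sandwichedTrace τ' α (Φ ρ) (Φ σ) ≤ sandwichedTrace τ α ρ σ := by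
  have hα0 : 0 < α := by linarith
  have hi : 0 < α⁻¹ := inv_pos.2 hα0
  have h := norm_pairing_le hτ hτ' hΦ htr hα hρ hσ (z := ((α⁻¹ : ℝ) : ℂ)) (by simpa using hi.le)
    (by simpa using inv_le_one_of_one_le₀ hα.le)
  have hQ := sandwichedTrace_nonneg hτ α hρ hσ
  have hQ' := sandwichedTrace_nonneg hτ' α (hΦ.nonneg hρ) (hΦ.nonneg hσ)
  rw [pairing_inv hτ' hΦ hα hρ hσ hP, Complex.norm_real, Real.norm_of_nonneg hQ',
    Complex.ofReal_re] at h
  rcases hQ'.eq_or_lt with h0 | hpos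
  · rw [← h0]
    exact hQ
  · rw [← Real.rpow_le_rpow_iff hQ' hQ hi]
    -- Splitting off the power `1 - α⁻¹` lets this factor of the three lines bound cancel.
    have h2 : sandwichedTrace τ' α (Φ ρ) (Φ σ) = sandwichedTrace τ' α (Φ ρ) (Φ σ) ^ (1 - α⁻¹)
        * sandwichedTrace τ' α (Φ ρ) (Φ σ) ^ α⁻¹ := by
      rw [← Real.rpow_add hpos, sub_add_cancel, Real.rpow_one]
    nth_rewrite 1 [h2] at h
    exact le_of_mul_le_mul_left h (Real.rpow_pos_of_pos hpos _)

/-- In the case of equality in the data processing inequality the pairing is constant. -/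
theorem pairing_eq_of_sandwichedTrace_eq (hτ : IsFaithfulTrace τ) (hτ' : IsFaithfulTrace τ')
    {Φ : A →ₗ[ℂ] B} (hΦ : IsCP Φ) (htr : ∀ a, τ' (Φ a) = τ a)
    {α : ℝ} (hα : 1 < α) {ρ σ : A} (hρ : 0 ≤ ρ) (hσ : 0 ≤ σ)
    (hP : cpw σ 0 * ρ * cpw σ 0 = ρ) (hpos : 0 < sandwichedTrace τ α ρ σ)
    (heq : sandwichedTrace τ' α (Φ ρ) (Φ σ) = sandwichedTrace τ α ρ σ) {z : ℂ}
    (h0 : 0 < z.re) (h1 : z.re < 1) :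
    pairing τ' Φ α σ (sandwich α ρ σ) (sandwich α (Φ ρ) (Φ σ)) z = sandwichedTrace τ α ρ σ := by
  have hα0 : 0 < α := by linarith
  have hc := pairing_inv hτ' hΦ hα hρ hσ hP
  rw [heq] at hc
  have hmem : ((α⁻¹ : ℝ) : ℂ) ∈ Complex.HadamardThreeLines.verticalStrip 0 1 := by
    refine ⟨?_, ?_⟩
    · simpa using hα0
    · simpa using inv_lt_one_of_one_lt₀ hα
  have hmax : IsMaxOn (norm ∘ pairing τ' Φ α σ (sandwich α ρ σ) (sandwich α (Φ ρ) (Φ σ)))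
      (Complex.HadamardThreeLines.verticalStrip 0 1) ((α⁻¹ : ℝ) : ℂ) := by
    intro w hw
    have h := norm_pairing_le hτ hτ' hΦ htr hα hρ hσ (z := w) hw.1.le hw.2.le
    -- With equal edge bounds the interpolated bound is the same constant throughout the strip, and
    -- `hc` says it is attained at 1/α.
    rw [heq, ← Real.rpow_add hpos, sub_add_cancel, Real.rpow_one] at h
    simp only [Set.mem_ofPred_eq, Function.comp_apply, hc, Complex.norm_real,
      Real.norm_of_nonneg hpos.le]
    exact h
  have hconv : Convex ℝ (Complex.HadamardThreeLines.verticalStrip 0 1) :=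
    (convex_Ioo (0 : ℝ) 1).linear_preimage Complex.reLm
  have hopen : IsOpen (Complex.HadamardThreeLines.verticalStrip 0 1) :=
    isOpen_Ioo.preimage Complex.continuous_re
  have h := Complex.eqOn_of_isPreconnected_of_isMaxOn_norm hconv.isPreconnected hopen
    (differentiable_pairing Φ α σ _ _).differentiableOn hmem hmax (show z ∈ _ from ⟨h0, h1⟩)
  rw [h, Function.const_apply, hc]

end DataProcessing

/-! ### The Petz map -/

section Recovery

variable {A : Type*} [CStarAlgebra A] [PartialOrder A] [StarOrderedRing A]
  [FiniteDimensional ℂ A]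
variable {B : Type*} [CStarAlgebra B] [PartialOrder B] [StarOrderedRing B]
  [FiniteDimensional ℂ B]
variable {τ : A →ₗ[ℂ] ℂ} {τ' : B →ₗ[ℂ] ℂ}

/-- The compression of the adjoint map `Φ'` by real powers of `σ` and `σ'`. -/
def compress (r r' : ℝ) (σ : A) (σ' : B) (Φ' : B →ₗ[ℂ] A) : B →ₗ[ℂ] A :=
  conjMap (cpw σ r) ∘ₗ Φ' ∘ₗ conjMap (cpw σ' r')

theorem compress_apply (r r' : ℝ) {σ : A} {σ' : B} (hσ : 0 ≤ σ) (hσ' : 0 ≤ σ')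
    (Φ' : B →ₗ[ℂ] A) (b : B) :
    compress r r' σ σ' Φ' b = cpw σ r * (Φ' (cpw σ' r' * (b * cpw σ' r')) * cpw σ r) := by
  simp only [compress, LinearMap.comp_apply, conjMap_apply, (isSelfAdjoint_cpw hσ r).star_eq,
    (isSelfAdjoint_cpw hσ' r').star_eq]

theorem cpw_mul_cpw_ofReal {a : A} {r s t : ℝ} (h : r + s = t) :
    cpw a (r : ℂ) * cpw a (s : ℂ) = cpw a (t : ℂ) := by
  rw [← cpw_add, ← h, Complex.ofReal_add]

theorem conj_cpw_self {a : A} (ha : 0 ≤ a) :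
    cpw a ((-1 / 2 : ℝ) : ℂ) * (a * cpw a ((-1 / 2 : ℝ) : ℂ)) = cpw a 0 := by
  nth_rewrite 2 [← cpw_one ha]
  rw [← Complex.ofReal_one, cpw_mul_cpw_ofReal rfl, cpw_mul_cpw_ofReal (t := 0) (by norm_num),
    Complex.ofReal_zero]

section

variable {Φ : A →ₗ[ℂ] B} {Φ' : B →ₗ[ℂ] A} {σ : A}
  (hτ : IsFaithfulTrace τ) (hτ' : IsFaithfulTrace τ') (hΦ : IsCP Φ) (htr : ∀ a, τ' (Φ a) = τ a)
  (hadj : ∀ a b, τ' (Φ a * b) = τ (a * Φ' b)) (hσ : 0 ≤ σ)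
include hτ hτ' hΦ htr hadj hσ

/-- On the support of `σ` the adjoint map sends the support projection of `Φ σ` to `1`. -/
theorem adjoint_support_mul_cpw (r : ℂ) : Φ' (cpw (Φ σ) 0) * cpw σ r = cpw σ r := by
  have hσ' := hΦ.nonneg hσ
  have hΦ' : IsCP Φ' := hΦ.adjoint hτ hτ' hadj
  have hone : Φ' 1 = 1 := hτ.ext_of_mul_left fun c => by rw [← hadj, mul_one, mul_one, htr]
  have hD : 0 ≤ 1 - Φ' (cpw (Φ σ) 0) := by
    rw [← hone, sub_nonneg]
    exact hΦ'.mono (cpw_zero_le_one hσ')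
  obtain ⟨m, hm⟩ := exists_eq_star_mul_self hD
  -- The positive defect `1 - Φ' (cpw (Φ σ) 0)` has zero expectation in `σ`, so by faithfulness it
  -- annihilates every power of `σ`.
  have hzero : τ (σ * (1 - Φ' (cpw (Φ σ) 0))) = 0 := by
    have h1 : Φ σ * cpw (Φ σ) 0 = Φ σ := by
      nth_rewrite 1 [← cpw_one hσ']
      rw [cpw_mul_cpw_zero, cpw_one hσ']
    rw [mul_sub, map_sub, ← hadj, h1, mul_one, htr, sub_self]
  have hms : m * cpw σ ((1 / 2 : ℝ) : ℂ) = 0 := by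
    apply hτ.eq_zero_of_re_star_mul_self
    have h2 : τ (star (m * cpw σ ((1 / 2 : ℝ) : ℂ)) * (m * cpw σ ((1 / 2 : ℝ) : ℂ))) = 0 := by
      rw [star_mul, (isSelfAdjoint_cpw hσ _).star_eq, hτ.comm, mul_assoc,
        ← mul_assoc (cpw σ _) (cpw σ _), cpw_half_mul_self hσ, hτ.comm, mul_assoc, ← hm, hzero]
    rw [h2, Complex.zero_re]
  have hmr : m * cpw σ r = 0 := by
    have : cpw σ r = cpw σ ((1 / 2 : ℝ) : ℂ) * cpw σ (r - (1 / 2 : ℝ)) := by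
      rw [← cpw_add, add_sub_cancel]
    rw [this, ← mul_assoc, hms, zero_mul]
  have h3 : (1 - Φ' (cpw (Φ σ) 0)) * cpw σ r = 0 := by rw [hm, mul_assoc, hmr, mul_zero]
  rw [sub_mul, one_mul, sub_eq_zero] at h3
  exact h3.symm

theorem compress_apply_self {r : ℝ} :
    compress r (-1 / 2) σ (Φ σ) Φ' (Φ σ) = cpw σ ((2 * r : ℝ) : ℂ) := by
  have hσ' := hΦ.nonneg hσ
  rw [compress_apply _ _ hσ hσ', conj_cpw_self hσ',
    adjoint_support_mul_cpw hτ hτ' hΦ htr hadj hσ, cpw_mul_cpw_ofReal (t := 2 * r) (by ring)]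

/-- The Petz map loses exactly the trace outside the support of `Φ σ`; this is the deficit that the
completion restores. -/
theorem trace_compress_apply (b : B) :
    τ (compress (1 / 2) (-1 / 2) σ (Φ σ) Φ' b) = τ' (b * cpw (Φ σ) 0) := by
  have hσ' := hΦ.nonneg hσ
  rw [compress_apply _ _ hσ hσ', hτ.comm, mul_assoc, cpw_half_mul_self hσ, hτ.comm, ← hadj,
    ← conj_cpw_self hσ', hτ'.comm, mul_assoc, hτ'.comm]
  simp only [mul_assoc]

/-- The Petz map, completed to a trace preserving completely positive map. -/
theorem exists_petz_completion (hσ1 : τ σ = 1) :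
    ∃ Ψ : B →ₗ[ℂ] A, IsCP Ψ ∧ (∀ b, τ (Ψ b) = τ' b) ∧ Ψ (Φ σ) = σ ∧
      ∀ ρ, compress (1 / 2) (-1 / 2) σ (Φ σ) Φ' (Φ ρ) = ρ → Ψ (Φ ρ) = ρ := by
  have hσ' := hΦ.nonneg hσ
  have hΦ' : IsCP Φ' := hΦ.adjoint hτ hτ' hadj
  have hP : 0 ≤ 1 - cpw (Φ σ) 0 := sub_nonneg.2 (cpw_zero_le_one hσ')
  let f : B →ₗ[ℂ] ℂ := τ' ∘ₗ LinearMap.mulRight ℂ (1 - cpw (Φ σ) 0)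
  have hf (b : B) : f b = τ' (b * (1 - cpw (Φ σ) 0)) := rfl
  have hfs (b : B) : f (star b) = starRingEnd ℂ (f b) := by
    rw [hf, hf, ← hτ'.map_star, star_mul, (IsSelfAdjoint.of_nonneg hP).star_eq, hτ'.comm]
  have hfn (b : B) : 0 ≤ f (star b * b) := by
    rw [Complex.le_def]
    refine ⟨hτ'.re_mul_nonneg (star_mul_self_nonneg b) hP, ?_⟩
    have := hfs (star b * b)
    rw [(IsSelfAdjoint.star_mul_self b).star_eq] at this
    exact (Complex.conj_eq_iff_im.1 this.symm).symm
  -- The lost trace `f b` is returned as `f b • σ`. This correction vanishes on any `Φ ρ` already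
  -- recovered by the Petz map, since no trace is lost there.
  let Ψ : B →ₗ[ℂ] A := compress (1 / 2) (-1 / 2) σ (Φ σ) Φ'
    + conjMap (cpw σ ((1 / 2 : ℝ) : ℂ)) ∘ₗ f.smulRight (1 : A)
  have hΨ (b : B) : Ψ b = compress (1 / 2) (-1 / 2) σ (Φ σ) Φ' b + f b • σ := by
    simp only [Ψ, LinearMap.add_apply, LinearMap.comp_apply, LinearMap.smulRight_apply, map_smul,
      conjMap_apply, (isSelfAdjoint_cpw hσ _).star_eq, one_mul, cpw_half_mul_self hσ]
  have hfix (ρ : A) (h : compress (1 / 2) (-1 / 2) σ (Φ σ) Φ' (Φ ρ) = ρ) : Ψ (Φ ρ) = ρ := by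
    have h1 := trace_compress_apply hτ hτ' hΦ htr hadj hσ (Φ ρ)
    rw [h] at h1
    rw [hΨ, h, hf, mul_sub, map_sub, mul_one, htr, ← h1, sub_self, zero_smul, add_zero]
  refine ⟨Ψ, ?_, fun b => ?_, hfix σ ?_, hfix⟩
  · exact ((isCP_conjMap _).comp (hΦ'.comp (isCP_conjMap _))).add
      ((isCP_conjMap _).comp (isCP_smulRight f hfs hfn (.one A)))
  · rw [hΨ, map_add, trace_compress_apply hτ hτ' hΦ htr hadj hσ, map_smul, hσ1, hf, mul_sub,
      map_sub, mul_one, smul_eq_mul, mul_one, add_sub_cancel]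
  · rw [compress_apply_self hτ hτ' hΦ htr hadj hσ]
    norm_num
    exact cpw_one hσ

/-- An element whose weighted 2-norm is not decreased by `Φ` is recovered by the Petz map. -/
theorem compress_apply_of_norm_le {a : A}
    (ha : (τ (star a * a)).re ≤ (τ'
      (star (cpw (Φ σ) ((-1 / 4 : ℝ) : ℂ)
          * Φ (cpw σ ((1 / 4 : ℝ) : ℂ) * a * cpw σ ((1 / 4 : ℝ) : ℂ))
          * cpw (Φ σ) ((-1 / 4 : ℝ) : ℂ))
        * (cpw (Φ σ) ((-1 / 4 : ℝ) : ℂ) * Φ (cpw σ ((1 / 4 : ℝ) : ℂ) * a * cpw σ ((1 / 4 : ℝ) : ℂ))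
          * cpw (Φ σ) ((-1 / 4 : ℝ) : ℂ)))).re) :
    compress (1 / 2) (-1 / 2) σ (Φ σ) Φ' (Φ (cpw σ ((1 / 4 : ℝ) : ℂ) * a * cpw σ ((1 / 4 : ℝ) : ℂ)))
      = cpw σ ((1 / 4 : ℝ) : ℂ) * a * cpw σ ((1 / 4 : ℝ) : ℂ) := by
  have hσ' := hΦ.nonneg hσ
  have hΦ' : IsCP Φ' := hΦ.adjoint hτ hτ' hadj
  set t := cpw σ ((1 / 4 : ℝ) : ℂ) with ht
  set t' := cpw (Φ σ) ((-1 / 4 : ℝ) : ℂ) with ht'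
  set s' := cpw (Φ σ) ((-1 / 2 : ℝ) : ℂ) with hs'
  have hst : IsSelfAdjoint t := isSelfAdjoint_cpw hσ _
  have hst' : IsSelfAdjoint t' := isSelfAdjoint_cpw hσ' _
  have htt : t * t = cpw σ ((1 / 2 : ℝ) : ℂ) := cpw_mul_cpw_ofReal (by norm_num)
  have htt' : t' * t' = s' := cpw_mul_cpw_ofReal (by norm_num)
  -- Distributing `σ` as quarter powers on both sides makes Petz after `Φ` symmetric for the trace
  -- form, with fixed vector σ^(1/2) and quadratic form equal to the weighted 2-norm in `ha`.
  let T : A →ₗ[ℂ] A := compress (1 / 4) (-1 / 2) σ (Φ σ) Φ' ∘ₗ Φ ∘ₗ conjMap t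
  have hT (x : A) : T x = t * (Φ' (s' * (Φ (t * x * t) * s')) * t) := by
    simp only [T, LinearMap.comp_apply, conjMap_apply, hst.star_eq, compress_apply _ _ hσ hσ',
      ← mul_assoc t x t]
    rfl
  have hcp : IsCP T := ((isCP_conjMap _).comp (hΦ'.comp (isCP_conjMap _))).comp
    (hΦ.comp (isCP_conjMap _))
  have hform (x y : A) : τ (x * T y) = τ' (Φ (t * x * t) * (s' * (Φ (t * y * t) * s'))) := by
    rw [hT, hadj, hτ.comm]
    simp only [mul_assoc]
    rw [hτ.comm]
    simp only [mul_assoc]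
    rw [hτ.comm]
    simp only [mul_assoc]
  have hsym (x y : A) : τ (star (T x) * y) = τ (star x * T y) := by
    rw [← hcp.map_star, hτ.comm, hform, hform, hτ'.comm]
    simp only [mul_assoc]
    rw [hτ'.comm]
    simp only [mul_assoc]
  have he : T (cpw σ ((1 / 2 : ℝ) : ℂ)) = cpw σ ((1 / 2 : ℝ) : ℂ) := by
    have h1 : t * cpw σ ((1 / 2 : ℝ) : ℂ) * t = σ := by
      conv_rhs => rw [← cpw_half_mul_self hσ]
      rw [← htt]
      simp only [mul_assoc]
    rw [hT, h1, conj_cpw_self hσ', adjoint_support_mul_cpw hτ hτ' hΦ htr hadj hσ, htt]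
  have hone : T 1 ≤ ‖Φ' (s' * (Φ (t * t) * s'))‖ • cpw σ ((1 / 2 : ℝ) : ℂ) := by
    have hsa : IsSelfAdjoint (Φ' (s' * (Φ (t * t) * s'))) := by
      have h1 : IsSelfAdjoint s' := isSelfAdjoint_cpw hσ' _
      rw [IsSelfAdjoint, ← hΦ'.map_star]
      simp only [star_mul, h1.star_eq, ← hΦ.map_star, hst.star_eq, mul_assoc]
    have h2 := star_left_conjugate_le_conjugate hsa.le_algebraMap_norm_self t
    rw [hT, ← htt, mul_one]
    rwa [hst.star_eq, Algebra.algebraMap_eq_smul_one, mul_smul_comm, mul_one, smul_mul_assoc,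
      mul_assoc] at h2
  have hquad : τ (star a * T a)
      = τ' (star (t' * Φ (t * a * t) * t') * (t' * Φ (t * a * t) * t')) := by
    have h1 : Φ (t * star a * t) = star (Φ (t * a * t)) := by
      rw [← hΦ.map_star]
      simp only [star_mul, hst.star_eq, mul_assoc]
    rw [hform, h1, ← htt']
    simp only [star_mul, hst'.star_eq, mul_assoc]
    rw [hτ'.comm t']
    simp only [mul_assoc]
  rw [← hquad] at ha
  have hfix := hτ.eq_of_le_quadratic_form (fun x hx => hcp.nonneg hx) hsym he hone ha
  calc compress (1 / 2) (-1 / 2) σ (Φ σ) Φ' (Φ (t * a * t)) = t * T a * t := by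
        rw [compress_apply _ _ hσ hσ', ← hs', hT, ← htt]
        simp only [mul_assoc]
    _ = t * a * t := by rw [hfix]

end

end Recovery

/-! ### Recovery from equality -/

section Equality

variable {A : Type*} [CStarAlgebra A] [PartialOrder A] [StarOrderedRing A]
  [FiniteDimensional ℂ A]
variable {B : Type*} [CStarAlgebra B] [PartialOrder B] [StarOrderedRing B]
  [FiniteDimensional ℂ B]
variable {τ : A →ₗ[ℂ] ℂ} {τ' : B →ₗ[ℂ] ℂ}

/-- Once the quarter powers are removed, the remaining powers of `σ` have imaginary exponents on Re
z = 1/2 and are contractions. -/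
theorem family_eq_conj (α : ℝ) (σ x : A) (z : ℂ) :
    family α σ x z = cpw σ ((1 / 4 : ℝ) : ℂ) *
      (cpw σ (1 / 4 - z / 2) * cpw x (α * z) * cpw σ (1 / 4 - z / 2))
        * cpw σ ((1 / 4 : ℝ) : ℂ) := by
  have h1 : (1 - z) / 2 = ((1 / 4 : ℝ) : ℂ) + (1 / 4 - z / 2) := by push_cast; ring
  have h2 : (1 - z) / 2 = (1 / 4 - z / 2) + ((1 / 4 : ℝ) : ℂ) := by push_cast; ring
  rw [family]
  nth_rewrite 1 [h1]
  rw [h2, cpw_add, cpw_add]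
  simp only [mul_assoc]

theorem dualFamily_eq_conj (α : ℝ) (σ x : A) (z : ℂ) :
    dualFamily α σ x z = cpw σ ((-1 / 4 : ℝ) : ℂ) *
      (cpw σ (z / 2 - 1 / 4) * cpw x (α * (1 - z)) * cpw σ (z / 2 - 1 / 4))
        * cpw σ ((-1 / 4 : ℝ) : ℂ) := by
  have h1 : -((1 - z) / 2) = ((-1 / 4 : ℝ) : ℂ) + (z / 2 - 1 / 4) := by push_cast; ring
  have h2 : -((1 - z) / 2) = (z / 2 - 1 / 4) + ((-1 / 4 : ℝ) : ℂ) := by push_cast; ring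
  rw [dualFamily]
  nth_rewrite 1 [h1]
  rw [h2, cpw_add, cpw_add]
  simp only [mul_assoc]

theorem re_middle_le (hτ : IsFaithfulTrace τ) {x : A} (hx : 0 ≤ x) {z : ℂ} {r : ℝ}
    (hz : 2 * z.re = r) {u v : A} (hu : ‖u‖ ≤ 1) (hv : ‖v‖ ≤ 1) :
    (τ (star (u * cpw x z * v) * (u * cpw x z * v))).re ≤ (τ (cpw x r)).re := by
  rw [mul_assoc]
  exact (hτ.re_contraction_mul_le hu _).trans (hτ.re_cpw_mul_contraction_le hx hz hv)

/-- Equality in the data processing inequality implies that the Petz map recovers `ρ`. -/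
theorem compress_apply_of_sandwichedTrace_eq (hτ : IsFaithfulTrace τ) (hτ' : IsFaithfulTrace τ')
    {Φ : A →ₗ[ℂ] B} (hΦ : IsCP Φ) (htr : ∀ a, τ' (Φ a) = τ a) {Φ' : B →ₗ[ℂ] A}
    (hadj : ∀ a b, τ' (Φ a * b) = τ (a * Φ' b))
    {α : ℝ} (hα : 1 < α) {ρ σ : A} (hρ : 0 ≤ ρ) (hσ : 0 ≤ σ)
    (hP : cpw σ 0 * ρ * cpw σ 0 = ρ) (hpos : 0 < sandwichedTrace τ α ρ σ)
    (heq : sandwichedTrace τ' α (Φ ρ) (Φ σ) = sandwichedTrace τ α ρ σ) :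
    compress (1 / 2) (-1 / 2) σ (Φ σ) Φ' (Φ ρ) = ρ := by
  have hσ' := hΦ.nonneg hσ
  have hx := sandwich_nonneg α hρ hσ
  have hy := sandwich_nonneg α (hΦ.nonneg hρ) hσ'
  set x := sandwich α ρ σ with hxdef
  set y := sandwich α (Φ ρ) (Φ σ) with hydef
  let R : A →ₗ[ℂ] A := compress (1 / 2) (-1 / 2) σ (Φ σ) Φ' ∘ₗ Φ
  have hline : ∀ z : ℂ, z.re = 1 / 2 → R (family α σ x z) = family α σ x z := by
    intro z hz
    have hpair := pairing_eq_of_sandwichedTrace_eq hτ hτ' hΦ htr hα hρ hσ hP hpos heq (z := z)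
      (by rw [hz]; norm_num) (by rw [hz]; norm_num)
    rw [← hxdef, ← hydef, pairing, dualFamily_eq_conj, family_eq_conj] at hpair
    rw [family_eq_conj]
    have ha := re_middle_le hτ hx (z := α * z) (r := α) (by simp [hz]; ring)
      (u := cpw σ (1 / 4 - z / 2)) (v := cpw σ (1 / 4 - z / 2))
      (norm_cpw_le_one hσ (by simp [hz]; norm_num)) (norm_cpw_le_one hσ (by simp [hz]; norm_num))
    have hb := re_middle_le hτ' hy (z := α * (1 - z)) (r := α) (by simp [hz]; ring)
      (u := cpw (Φ σ) (z / 2 - 1 / 4)) (v := cpw (Φ σ) (z / 2 - 1 / 4))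
      (norm_cpw_le_one hσ' (by simp [hz]; norm_num)) (norm_cpw_le_one hσ' (by simp [hz]; norm_num))
    set a := cpw σ (1 / 4 - z / 2) * cpw x (α * z) * cpw σ (1 / 4 - z / 2)
    set b := cpw (Φ σ) (z / 2 - 1 / 4) * cpw y (α * (1 - z)) * cpw (Φ σ) (z / 2 - 1 / 4)
    refine compress_apply_of_norm_le hτ hτ' hΦ htr hadj hσ ?_
    set t := cpw σ ((1 / 4 : ℝ) : ℂ)
    set t' := cpw (Φ σ) ((-1 / 4 : ℝ) : ℂ)
    have h1 : τ' (Φ (t * a * t) * (t' * b * t'))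
        = τ' (star (star b) * (t' * Φ (t * a * t) * t')) := by
      rw [star_star, hτ'.comm]
      simp only [mul_assoc]
      rw [hτ'.comm t']
      simp only [mul_assoc]
    -- Equality case of Cauchy–Schwarz: the inner product is Q and `b` has squared norm at most Q,
    -- so the transported `a` has squared norm at least Q, hence at least that of `a`.
    have h2 := hτ'.re_star_mul_self_nonneg (star b - t' * Φ (t * a * t) * t')
    rw [hτ'.re_star_sub_mul_sub, ← h1, hpair, star_star, hτ'.comm, Complex.ofReal_re] at h2
    rw [sandwichedTrace, ← hydef] at heq
    rw [heq] at hb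
    rw [sandwichedTrace, ← hxdef] at h2 hb
    linarith
  have hentire : (fun z => R (family α σ x z)) = family α σ x := by
    have hd : Differentiable ℂ fun z => R (family α σ x z) :=
      (LinearMap.toContinuousLinearMap R).differentiable.comp (differentiable_family α σ x)
    -- The line Re z = 1/2 accumulates at 1/2, which suffices for the identity theorem.
    refine AnalyticOnNhd.eq_of_frequently_eq (z₀ := (1 / 2 : ℂ))
      (fun z _ => hd.analyticAt z) (fun z _ => (differentiable_family α σ x).analyticAt z) ?_
    have ht : Filter.Tendsto (fun s : ℝ => (1 / 2 + s * Complex.I : ℂ)) (nhdsWithin 0 {0}ᶜ)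
        (nhdsWithin (1 / 2 : ℂ) {1 / 2}ᶜ) := by
      refine tendsto_nhdsWithin_iff.2 ⟨?_, ?_⟩
      · have : Continuous fun s : ℝ => (1 / 2 + s * Complex.I : ℂ) := by fun_prop
        simpa using (this.tendsto 0).mono_left nhdsWithin_le_nhds
      · filter_upwards [self_mem_nhdsWithin] with s hs
        simpa using hs
    refine ht.frequently (Filter.Eventually.frequently (Filter.Eventually.of_forall fun s => ?_))
    exact hline _ (by simp)
  have h := congrFun hentire ((α⁻¹ : ℝ) : ℂ)
  rwa [hxdef, family_inv hα hρ hσ hP] at h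

theorem sandwichedTrace_pos (hτ : IsFaithfulTrace τ) {α : ℝ} (hα : 1 < α) {ρ σ : A} (hρ : 0 ≤ ρ)
    (hσ : 0 ≤ σ) (hP : cpw σ 0 * ρ * cpw σ 0 = ρ) (hne : ρ ≠ 0) :
    0 < sandwichedTrace τ α ρ σ := by
  refine lt_of_le_of_ne (sandwichedTrace_nonneg hτ α hρ hσ) fun h => hne ?_
  have hx := sandwich_nonneg α hρ hσ
  have h0 := hτ.eq_zero_of_re_eq_zero (cpw_nonneg hx α) h.symm
  have h1 : sandwich α ρ σ = 0 := by
    rw [← cpw_one hx, ← add_sub_cancel (α : ℂ) 1, cpw_add, h0, zero_mul]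
  have h2 := family_inv hα hρ hσ hP
  have hα0 : (α : ℂ) ≠ 0 := by
    norm_cast
    positivity
  rw [family, Complex.ofReal_inv, mul_inv_cancel₀ hα0, cpw_one hx, h1, mul_zero, zero_mul] at h2
  exact h2.symm

/-- Equality in the data processing inequality implies the existence of a recovery map. -/
theorem exists_recovery (hτ : IsFaithfulTrace τ) (hτ' : IsFaithfulTrace τ')
    {Φ : A →ₗ[ℂ] B} (hΦ : IsCP Φ) (htr : ∀ a, τ' (Φ a) = τ a)
    {α : ℝ} (hα : 1 < α) {ρ σ : A} (hρ : 0 ≤ ρ) (hσ : 0 ≤ σ) (hσ1 : τ σ = 1)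
    (hP : cpw σ 0 * ρ * cpw σ 0 = ρ) (hpos : 0 < sandwichedTrace τ α ρ σ)
    (heq : sandwichedTrace τ' α (Φ ρ) (Φ σ) = sandwichedTrace τ α ρ σ) :
    ∃ Ψ : B →ₗ[ℂ] A, IsCP Ψ ∧ (∀ b, τ (Ψ b) = τ' b) ∧ Ψ (Φ σ) = σ ∧ Ψ (Φ ρ) = ρ := by
  obtain ⟨Φ', hadj⟩ := hτ.exists_adjoint τ' Φ
  obtain ⟨Ψ, h1, h2, h3, h4⟩ := exists_petz_completion hτ hτ' hΦ htr hadj hσ hσ1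
  exact ⟨Ψ, h1, h2, h3, h4 ρ
    (compress_apply_of_sandwichedTrace_eq hτ hτ' hΦ htr hadj hα hρ hσ hP hpos heq)⟩

end Equality

/-! ### Operators on finite dimensional Hilbert spaces -/

section Concrete

variable {A : Type*} [CStarAlgebra A] [PartialOrder A] [StarOrderedRing A]
  [FiniteDimensional ℂ A]
variable {H : Type*} [NormedAddCommGroup H] [InnerProductSpace ℂ H] [CompleteSpace H]
  [FiniteDimensional ℂ H]
variable {K : Type*} [NormedAddCommGroup K] [InnerProductSpace ℂ K] [CompleteSpace K]
  [FiniteDimensional ℂ K]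

/-- Domination by a multiple of `σ` expresses support inclusion in a form that positive maps
preserve. -/
theorem exists_le_smul_of_cpw_zero_mul {ρ σ : A} (hρ : 0 ≤ ρ) (hσ : 0 ≤ σ)
    (hP : cpw σ 0 * ρ * cpw σ 0 = ρ) : ∃ c : ℝ, ρ ≤ c • σ := by
  have h1 : ρ ≤ ‖ρ‖ • cpw σ 0 := by
    have h := star_left_conjugate_le_conjugate (IsSelfAdjoint.of_nonneg hρ).le_algebraMap_norm_self
      (cpw σ 0)
    rwa [(cpw_zero_isSelfAdjoint hσ).star_eq, hP, Algebra.algebraMap_eq_smul_one, mul_smul_comm,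
      mul_one, smul_mul_assoc, cpw_zero_mul_self] at h
  have h2 : cpw σ 0 ≤ ‖cpw σ ((-1 : ℝ) : ℂ)‖ • σ := by
    have h := star_left_conjugate_le_conjugate
      (isSelfAdjoint_cpw hσ (-1)).le_algebraMap_norm_self (cpw σ ((1 / 2 : ℝ) : ℂ))
    rwa [(isSelfAdjoint_cpw hσ _).star_eq, Algebra.algebraMap_eq_smul_one, mul_smul_comm,
      mul_one, smul_mul_assoc, cpw_half_mul_self hσ, cpw_mul_cpw_ofReal rfl,
      cpw_mul_cpw_ofReal (t := 0) (by norm_num), Complex.ofReal_zero] at h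
  refine ⟨‖ρ‖ * ‖cpw σ ((-1 : ℝ) : ℂ)‖, h1.trans ?_⟩
  rw [mul_smul]
  exact smul_le_smul_of_nonneg_left h2 (norm_nonneg _)

variable (H) in
/-- The trace as a linear functional. -/
def traceₗ : (H →L[ℂ] H) →ₗ[ℂ] ℂ :=
  LinearMap.trace ℂ H ∘ₗ ContinuousLinearMap.coeLM ℂ

theorem traceₗ_apply (X : H →L[ℂ] H) : traceₗ H X = trace X := rfl

theorem traceₗ_eq_sum (X : H →L[ℂ] H) :
    traceₗ H X = ∑ i, inner ℂ (stdOrthonormalBasis ℂ H i) (X (stdOrthonormalBasis ℂ H i)) :=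
  LinearMap.trace_eq_sum_inner _ (stdOrthonormalBasis ℂ H)

variable (H) in
theorem isFaithfulTrace_traceₗ : IsFaithfulTrace (traceₗ H) where
  comm a b := LinearMap.trace_mul_comm ℂ (a : H →ₗ[ℂ] H) b
  map_star a := by
    rw [traceₗ_eq_sum, traceₗ_eq_sum, map_sum]
    refine Finset.sum_congr rfl fun i _ => ?_
    rw [ContinuousLinearMap.star_eq_adjoint, ContinuousLinearMap.adjoint_inner_right,
      inner_conj_symm]
  re_pos a ha := by
    rw [traceₗ_eq_sum, Complex.re_sum]
    have h (i) : (inner ℂ (stdOrthonormalBasis ℂ H i)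
        ((star a * a) (stdOrthonormalBasis ℂ H i))).re = ‖a (stdOrthonormalBasis ℂ H i)‖ ^ 2 := by
      rw [mul_apply_eq_comp, ContinuousLinearMap.star_eq_adjoint,
        ContinuousLinearMap.adjoint_inner_right, inner_self_eq_norm_sq_to_K]
      norm_cast
    simp only [h]
    obtain ⟨i, hi⟩ : ∃ i, a (stdOrthonormalBasis ℂ H i) ≠ 0 := by
      by_contra! h0
      refine ha (ContinuousLinearMap.coe_injective ?_)
      exact (stdOrthonormalBasis ℂ H).toBasis.ext fun i => by simpa using h0 i
    exact Finset.sum_pos' (fun _ _ => by positivity) ⟨i, Finset.mem_univ _, by positivity⟩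

theorem ker_le_ker_of_le_smul {ρ σ : H →L[ℂ] H} (hρ : 0 ≤ ρ) {c : ℝ} (h : ρ ≤ c • σ) :
    LinearMap.ker σ.toLinearMap ≤ LinearMap.ker ρ.toLinearMap := by
  intro v hv
  have hv0 : σ v = 0 := hv
  obtain ⟨s, rfl⟩ := exists_eq_star_mul_self hρ
  have h1 := ((ContinuousLinearMap.le_def _ _).1 h).inner_nonneg_right v
  rw [sub_apply, smul_apply, hv0, smul_zero, zero_sub,
    inner_neg_right, mul_apply_eq_comp, ContinuousLinearMap.star_eq_adjoint,
    ContinuousLinearMap.adjoint_inner_right, inner_self_eq_norm_sq_to_K] at h1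
  have h2 : ‖s v‖ ^ 2 ≤ 0 := by
    have := (Complex.le_def.1 h1).1
    rw [Complex.neg_re, Complex.zero_re] at this
    norm_cast at this
    simp only [Complex.coe_algebraMap] at this
    norm_cast at this
    linarith
  have h3 : s v = 0 := by
    rw [← norm_eq_zero]
    nlinarith [norm_nonneg (s v)]
  change star s (s v) = 0
  rw [h3, map_zero]

theorem supp_le_supp_iff {ρ σ : H →L[ℂ] H} :
    supp ρ ≤ supp σ ↔ LinearMap.ker σ.toLinearMap ≤ LinearMap.ker ρ.toLinearMap :=
  Submodule.orthogonal_le_orthogonal_iff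

theorem cpw_zero_mul_of_supp_le {ρ σ : H →L[ℂ] H} (hρ : 0 ≤ ρ) (hσ : 0 ≤ σ)
    (h : supp ρ ≤ supp σ) : cpw σ 0 * ρ * cpw σ 0 = ρ := by
  have h0 : ρ * (1 - cpw σ 0) = 0 := by
    ext v
    refine supp_le_supp_iff.1 h (show (1 - cpw σ 0) v ∈ LinearMap.ker σ.toLinearMap from ?_)
    have h1 : σ * (1 - cpw σ 0) = 0 := by
      nth_rewrite 1 [← cpw_one hσ]
      rw [mul_sub, cpw_mul_cpw_zero, mul_one, sub_self]
    exact congrArg (fun X : H →L[ℂ] H => X v) h1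
  have h2 : ρ * cpw σ 0 = ρ := by
    rw [mul_sub, mul_one, sub_eq_zero] at h0
    exact h0.symm
  have h3 : cpw σ 0 * ρ = ρ := by
    have := congrArg star h2
    rwa [star_mul, (cpw_zero_isSelfAdjoint hσ).star_eq,
      (IsSelfAdjoint.of_nonneg hρ).star_eq] at this
  rw [h3, h2]

theorem supp_le_supp_map {Φ : (H →L[ℂ] H) →ₗ[ℂ] (K →L[ℂ] K)} (hΦ : IsCP Φ) {ρ σ : H →L[ℂ] H}
    (hρ : 0 ≤ ρ) (hσ : 0 ≤ σ) (h : supp ρ ≤ supp σ) : supp (Φ ρ) ≤ supp (Φ σ) := by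
  obtain ⟨c, hc⟩ := exists_le_smul_of_cpw_zero_mul hρ hσ (cpw_zero_mul_of_supp_le hρ hσ h)
  rw [supp_le_supp_iff]
  refine ker_le_ker_of_le_smul (hΦ.nonneg hρ) (c := c) ?_
  rw [← Complex.coe_smul, ← map_smul, Complex.coe_smul]
  exact hΦ.mono hc

theorem ne_zero_of_trace_eq_one {X : H →L[ℂ] H} (hX : traceₗ H X = 1) : X ≠ 0 := by
  rintro rfl
  simp at hX

theorem sandwichedRenyi_eq {α : ℝ} (hα : 1 < α) {ρ σ : H →L[ℂ] H} (hρ : 0 ≤ ρ) (hσ : 0 ≤ σ)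
    (h : supp ρ ≤ supp σ) : sandwichedRenyi α ρ σ
      = ((1 / (α - 1) * Real.logb 2 (sandwichedTrace (traceₗ H) α ρ σ) : ℝ) : EReal) := by
  have hα0 : α ≠ 0 := by positivity
  have hs : (1 - α) / (2 * α) ≠ 0 := div_ne_zero (by linarith) (by positivity)
  rw [sandwichedRenyi, if_pos h, rpow_eq_cpw hσ hs, sandwichedTrace, traceₗ_apply]
  rw [rpow_eq_cpw (show 0 ≤ cpw σ (((1 - α) / (2 * α) : ℝ) : ℂ) * ρ *
    cpw σ (((1 - α) / (2 * α) : ℝ) : ℂ) from sandwich_nonneg α hρ hσ) hα0]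
  rfl

end Concrete

end QuantumRenyi

end

/-! ### The equivalence -/

theorem mainTheorem1
    {H : Type*} [NormedAddCommGroup H] [InnerProductSpace ℂ H] [CompleteSpace H]
    [FiniteDimensional ℂ H]
    {K : Type*} [NormedAddCommGroup K] [InnerProductSpace ℂ K] [CompleteSpace K]
    [FiniteDimensional ℂ K]
    (Φ : QuantumRenyi.QuantumChannel H K) (α : ℝ) (hα : 1 < α)
    (ρ σ : H →L[ℂ] H) (hρ : QuantumRenyi.IsState ρ) (hσ : QuantumRenyi.IsState σ)
    (hsupp : QuantumRenyi.supp ρ ≤ QuantumRenyi.supp σ) :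
    Φ.IsSufficient ρ σ ↔
      QuantumRenyi.sandwichedRenyi α (Φ ρ) (Φ σ) = QuantumRenyi.sandwichedRenyi α ρ σ := by
  have hτ := QuantumRenyi.isFaithfulTrace_traceₗ H
  have hτ' := QuantumRenyi.isFaithfulTrace_traceₗ K
  have hΦ : QuantumRenyi.IsCP Φ.toLinearMap := Φ.map_cstarMatrix_nonneg'
  have hρ' := hΦ.nonneg hρ.nonneg
  have hσ' := hΦ.nonneg hσ.nonneg
  have hsupp' := QuantumRenyi.supp_le_supp_map hΦ hρ.nonneg hσ.nonneg hsupp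
  have hP := QuantumRenyi.cpw_zero_mul_of_supp_le hρ.nonneg hσ.nonneg hsupp
  have hP' := QuantumRenyi.cpw_zero_mul_of_supp_le hρ' hσ' hsupp'
  have hpos := QuantumRenyi.sandwichedTrace_pos hτ hα hρ.nonneg hσ.nonneg hP
    (QuantumRenyi.ne_zero_of_trace_eq_one hρ.trace_eq_one)
  have hpos' := QuantumRenyi.sandwichedTrace_pos hτ' hα hρ' hσ' hP'
    (QuantumRenyi.ne_zero_of_trace_eq_one ((Φ.trace_map ρ).trans hρ.trace_eq_one))
  rw [QuantumRenyi.sandwichedRenyi_eq hα hρ.nonneg hσ.nonneg hsupp,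
    QuantumRenyi.sandwichedRenyi_eq hα hρ' hσ' hsupp']
  constructor
  · rintro ⟨Ψ, hΨρ, hΨσ⟩
    have hΨ : QuantumRenyi.IsCP Ψ.toLinearMap := Ψ.map_cstarMatrix_nonneg'
    -- Data processing through `Φ` and then back through `Ψ` gives both inequalities.
    have h1 := QuantumRenyi.sandwichedTrace_le hτ hτ' hΦ Φ.trace_map hα hρ.nonneg hσ.nonneg hP
    have h2 := QuantumRenyi.sandwichedTrace_le hτ' hτ hΨ Ψ.trace_map hα hρ' hσ' hP'
    rw [hΨρ, hΨσ] at h2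
    rw [le_antisymm h1 h2]
  · intro h
    have hα1 : 1 / (α - 1) ≠ 0 := one_div_ne_zero (by linarith)
    have heq : QuantumRenyi.sandwichedTrace (QuantumRenyi.traceₗ K) α (Φ ρ) (Φ σ)
        = QuantumRenyi.sandwichedTrace (QuantumRenyi.traceₗ H) α ρ σ :=
      Real.logb_injOn_pos one_lt_two hpos' hpos (mul_left_cancel₀ hα1 (EReal.coe_injective h))
    obtain ⟨Ψ, h1, h2, h3, h4⟩ := QuantumRenyi.exists_recovery hτ hτ' hΦ Φ.trace_map hα
      hρ.nonneg hσ.nonneg hσ.trace_eq_one hP hpos heq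
    exact ⟨⟨⟨Ψ, h1⟩, h2⟩, h4, h3⟩
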